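/- **Setting.** Let $d\ge 1$ and $\rho>0$. Let $\mathsf G=(G_{ijkl}(t))_{t>0}$ be the relaxation modulus of a linear viscoelastic solid. That is, for every $t>0$, $\mathsf G(t)$ is a symmetric operator on the space $S$ of real symmetric $d\times d$ matrices with the scalar product $\langle E,C\rangle=E_{ij}C_{ij}$ (so $G_{ijkl}=G_{jikl}=G_{klij}$); for every $E\in S$ the function $t\mapsto\langle E,\mathsf G(t)E\rangle$ is completely monotonic on $]0,\infty[$ (it is $C^\infty$ and its $n$-th derivative has the sign $(-1)^n$, i.e. $(-1)^n\,\mathrm d^n/\mathrm dt^n\ge 0$); $\mathsf G$ is integrable on $]0,1]$; the limit $\lim_{t\to0+}\mathsf G(t)$ exists and is finite; and $\lim_{t\to\infty}\mathsf G(t)$ exists and is positive definite on $S$. For a unit vector $\mathbf n\in\mathbb R^d$ and $p>0$ put $$\mathsf Q(p)=p\int_0^\infty e^{-pt}\,\mathsf G(t)\,dt,\qquad (\mathbf Q_{\mathbf n}(p))_{ik}=\sum_{j,l}Q_{ijkl}(p)\,n_jn_l,\qquad \mathbf K_{\mathbf n}(p)=\rho^{1/2}\,p\,\mathbf Q_{\mathbf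 n}(p)^{-1/2},$$ with the principal square root of the positive definite matrix $\mathbf Q_{\mathbf n}(p)$. A real $m\times m$ matrix-valued function $\mathbf A$ on $]0,\infty[$ is called a *complete Bernstein function* (CBF) if it has an analytic continuation to $\mathbb C\setminus\,]-\infty,0]$ with $\operatorname{Im}z\,\operatorname{Im}\mathbf A(z)\ge0$, where $\operatorname{Im}\mathbf B=(\mathbf B-\mathbf B^\dagger)/(2\mathrm i)$, and if $\lim_{x\to0+}\mathbf A(x)$ exists and is real and positive semi-definite. For $m=1$ this is a scalar CBF. Also $\operatorname{Re}\mathbf B=(\mathbf B+\mathbf B^\dagger)/2$. **Theorem.** (1) Let $\mathbf f\in\mathbb R^d$ be a unit vector, independent of $p$, with $\mathbf K_{\mathbf n}(p)\mathbf f=\kappa(p)\mathbf f$ for all $p>0$. Then $\kappa(p)=\mathbf f^\top\mathbf K_{\mathbf n}(p)\mathbf f$ for all $p>0$, and $\kappa$ is a scalar CBF. (2) Let $d=3$ and let the medium be transversely isotropic with the constant symmetry axis $\mathbf e=[0,0,1]^\top$: for all $p>0$, $\mathsf Q(p)$ is given in the Voigt notation (pairs ordered $11,22,33,23,13,12$)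 by $$\begin{bmatrix}q_{11}&q_{12}&q_{13}&0&0&0\\q_{12}&q_{11}&q_{13}&0&0&0\\q_{13}&q_{13}&q_{33}&0&0&0\\0&0&0&q_{44}&0&0\\0&0&0&0&q_{44}&0\\0&0&0&0&0&q_{66}\end{bmatrix}(p),\qquad q_{12}=q_{11}-2q_{66}.$$ Let $\mathbf n$ be a unit vector with $(\mathbf e\cdot\mathbf n)^2\ne1$ and let $\mathbf f=(1-(\mathbf e\cdot\mathbf n)^2)^{-1/2}\,\mathbf e\times\mathbf n$. Then: * $\mathbf f$ is a unit vector, and for all $p>0$, $\mathbf Q_{\mathbf n}(p)\mathbf f=q^{\mathrm T}(p)\mathbf f$ and $\mathbf K_{\mathbf n}(p)\mathbf f=\kappa^{\mathrm T}(p)\mathbf f$, with $q^{\mathrm T}=q_{66}(1-(\mathbf e\cdot\mathbf n)^2)+q_{44}(\mathbf e\cdot\mathbf n)^2>0$ and $\kappa^{\mathrm T}(p)=\rho^{1/2}p/q^{\mathrm T}(p)^{1/2}$. The function $\kappa^{\mathrm T}$ is a scalar CBF. * $\mathbf K_{\mathbf n}$ and $\kappa^{\mathrm T}$ have analytic continuations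 to $\mathbb C\setminus\,]-\infty,0]$, denoted by the same letters. For all real $\omega\ne0$, $\kappa^{\mathrm T}(-\mathrm i\omega)=-\mathrm i\omega/c^{\mathrm T}(\omega)+\mathcal A^{\mathrm T}(\omega)$ with $c^{\mathrm T}(\omega)>0$ and the scalar attenuation function $\mathcal A^{\mathrm T}(\omega)=\operatorname{Re}\kappa^{\mathrm T}(-\mathrm i\omega)\ge0$. * There is a rotation $\mathbf R$ with $\mathbf R\mathbf f=[0,0,1]^\top$. For every such rotation there is a $2\times2$ matrix-valued CBF $\mathbf K^\perp_{\mathbf n}$, with an analytic continuation to $\mathbb C\setminus\,]-\infty,0]$ denoted by the same letter, such that for all $z\in\mathbb C\setminus\,]-\infty,0]$ (in particular for all $z=p>0$), all $y\in\mathbb R$ and all real $\omega\neq0$ $$\mathbf R\,\mathbf K_{\mathbf n}(z)\,\mathbf R^{\top}=\begin{bmatrix}\mathbf K^\perp_{\mathbf n}(z)&0\\0&\kappa^{\mathrm T}(z)\end{bmatrix},\qquad \mathbf R\,e^{-y\mathbf K_{\mathbf n}(z)}\,\mathbf R^{\top}=\begin{bmatrix}e^{-y\mathbf K^\perp_{\mathbf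 n}(z)}&0\\0&e^{-y\kappa^{\mathrm T}(z)}\end{bmatrix},$$ $$\mathbf R\,\operatorname{Re}\mathbf K_{\mathbf n}(-\mathrm i\omega)\,\mathbf R^{\top}=\begin{bmatrix}\operatorname{Re}\mathbf K^\perp_{\mathbf n}(-\mathrm i\omega)&0\\0&\mathcal A^{\mathrm T}(\omega)\end{bmatrix},\qquad \operatorname{Re}\mathbf K^\perp_{\mathbf n}(-\mathrm i\omega)\ge0 .$$ -/

import Mathlib

open Set Filter Topology MeasureTheory
open scoped Matrix ContDiff ComplexOrder

noncomputable section

namespace Viscoelastic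

/-- Rank-4 tensors over `ℝ^d`, in the fixed Cartesian coordinates, as arrays of components. -/
abbrev Tensor4 (d : ℕ) : Type := Fin d → Fin d → Fin d → Fin d → ℝ

/-- The minor and major symmetries: they say that `E ↦ (H i j k l E k l)` is a symmetric operator
on the space of symmetric `d × d` matrices with the scalar product `E i j C i j`. -/
def Tensor4.IsSymmetric {d : ℕ} (H : Tensor4 d) : Prop :=
  (∀ i j k l, H i j k l = H j i k l) ∧ (∀ i j k l, H i j k l = H k l i j)

/-- The quadratic form `⟨E, H E⟩` of a rank-4 tensor. -/
def Tensor4.quad {d : ℕ} (H : Tensor4 d) (E : Matrix (Fin d) (Fin d) ℝ) : ℝ :=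
  ∑ i, ∑ j, ∑ k, ∑ l, E i j * H i j k l * E k l

/-- The matrix with entries `H i j k l n j n l`, as a function of `i` and `k`. -/
def Tensor4.contract {d : ℕ} (H : Tensor4 d) (n : Fin d → ℝ) : Matrix (Fin d) (Fin d) ℝ :=
  Matrix.of fun i k => ∑ j, ∑ l, H i j k l * n j * n l

/-- Completely monotonic functions on `]0, ∞[`. -/
def IsCM (f : ℝ → ℝ) : Prop :=
  ContDiffOn ℝ ∞ f (Ioi 0) ∧ ∀ (n : ℕ) (t : ℝ), 0 < t → 0 ≤ (-1) ^ n * iteratedDeriv n f t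

/-- `G` is the relaxation modulus of a linear viscoelastic solid: a locally integrable completely
monotonic function on `]0, ∞[` with values in the symmetric operators on symmetric matrices, with
a finite limit at `0+` and a positive definite limit at infinity. -/
structure IsSolidModulus {d : ℕ} (G : ℝ → Tensor4 d) : Prop where
  symm : ∀ t, 0 < t → (G t).IsSymmetric
  cm : ∀ E : Matrix (Fin d) (Fin d) ℝ, E.IsSymm → IsCM fun t => (G t).quad E
  integrable : ∀ i j k l, IntegrableOn (fun t => G t i j k l) (Ioc 0 1)
  limit_zero : ∃ G₀ : Tensor4 d, Tendsto G (𝓝[>] 0) (𝓝 G₀)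
  limit_infty : ∃ G₁ : Tensor4 d, Tendsto G atTop (𝓝 G₁) ∧
    ∀ E : Matrix (Fin d) (Fin d) ℝ, E.IsSymm → E ≠ 0 → 0 < G₁.quad E

/-- `Q(p) = p ∫₀^∞ exp(-p t) G(t) dt` for `p > 0`. -/
def modulusQ {d : ℕ} (G : ℝ → Tensor4 d) (p : ℝ) : Tensor4 d :=
  fun i j k l => p * ∫ t in Ioi (0 : ℝ), Real.exp (-p * t) * G t i j k l

/-- `Q_n(p)`, with entries `Q i j k l (p) n j n l`, for `p > 0`. -/
def matrixQ {d : ℕ} (G : ℝ → Tensor4 d) (n : Fin d → ℝ) (p : ℝ) : Matrix (Fin d) (Fin d) ℝ :=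
  (modulusQ G p).contract n

/-- `K_n(p) = ρ^{1/2} p Q_n(p)^{-1/2}` for `p > 0`. The principal square root of the real symmetric
positive definite matrix `Q_n(p)` is given by the functional calculus. -/
def matrixK {d : ℕ} (ρ : ℝ) (G : ℝ → Tensor4 d) (n : Fin d → ℝ) (p : ℝ) :
    Matrix (Fin d) (Fin d) ℝ :=
  (Real.sqrt ρ * p) • (cfc Real.sqrt (matrixQ G n p))⁻¹

/-- `F` is the analytic continuation to the cut plane `ℂ ∖ ]-∞, 0]` of the real function `f` on
`]0, ∞[`. -/
def IsContinuation (f : ℝ → ℝ) (F : ℂ → ℂ) : Prop :=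
  DifferentiableOn ℂ F Complex.slitPlane ∧ ∀ x : ℝ, 0 < x → F x = f x

/-- Analytic continuation to the cut plane of a matrix-valued function, entry by entry. -/
def IsMatrixContinuation {m : ℕ} (A : ℝ → Matrix (Fin m) (Fin m) ℝ)
    (F : ℂ → Matrix (Fin m) (Fin m) ℂ) : Prop :=
  ∀ i j, IsContinuation (fun x => A x i j) (fun z => F z i j)

/-- Scalar complete Bernstein functions on `]0, ∞[`. -/
def IsCBF (f : ℝ → ℝ) : Prop :=
  (∃ F : ℂ → ℂ, IsContinuation f F ∧ ∀ z ∈ Complex.slitPlane, 0 ≤ z.im * (F z).im) ∧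
    ∃ b : ℝ, 0 ≤ b ∧ Tendsto f (𝓝[>] 0) (𝓝 b)

/-- The Hermitian real part `(B + B†) / 2`. -/
def rePart {m : ℕ} (B : Matrix (Fin m) (Fin m) ℂ) : Matrix (Fin m) (Fin m) ℂ :=
  (1 / 2 : ℂ) • (B + Bᴴ)

/-- The Hermitian imaginary part `(B - B†) / (2 i)`. -/
def imPart {m : ℕ} (B : Matrix (Fin m) (Fin m) ℂ) : Matrix (Fin m) (Fin m) ℂ :=
  (1 / (2 * Complex.I) : ℂ) • (B - Bᴴ)

/-- Matrix-valued complete Bernstein functions on `]0, ∞[`. -/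
def IsMatrixCBF {m : ℕ} (A : ℝ → Matrix (Fin m) (Fin m) ℝ) : Prop :=
  (∃ F : ℂ → Matrix (Fin m) (Fin m) ℂ, IsMatrixContinuation A F ∧
      ∀ z ∈ Complex.slitPlane, ((z.im : ℂ) • imPart (F z)).PosSemidef) ∧
    ∃ B : Matrix (Fin m) (Fin m) ℝ, B.PosSemidef ∧ Tendsto A (𝓝[>] 0) (𝓝 B)

/-- The Voigt pairs `11, 22, 33, 23, 13, 12`. -/
def voigtPair : Fin 6 → Fin 3 × Fin 3 :=
  ![(0, 0), (1, 1), (2, 2), (1, 2), (0, 2), (0, 1)]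

/-- The `6 × 6` matrix of a rank-4 tensor over `ℝ³` in the Voigt notation. -/
def voigt (H : Tensor4 3) : Matrix (Fin 6) (Fin 6) ℝ :=
  Matrix.of fun I J => H (voigtPair I).1 (voigtPair I).2 (voigtPair J).1 (voigtPair J).2

/-- The unit vector of the third coordinate axis. -/
def e₃ : Fin 3 → ℝ := ![0, 0, 1]

/-- The medium is transversely isotropic with the constant symmetry axis `e₃`, and `qIJ(p)` are the
components of `Q(p)` in the Voigt notation. -/
def IsTransverselyIsotropic (G : ℝ → Tensor4 3) (q11 q12 q13 q33 q44 q66 : ℝ → ℝ) : Prop :=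
  ∀ p : ℝ, 0 < p →
    voigt (modulusQ G p) =
      !![q11 p, q12 p, q13 p, 0, 0, 0;
         q12 p, q11 p, q13 p, 0, 0, 0;
         q13 p, q13 p, q33 p, 0, 0, 0;
         0, 0, 0, q44 p, 0, 0;
         0, 0, 0, 0, q44 p, 0;
         0, 0, 0, 0, 0, q66 p] ∧
    q12 p = q11 p - 2 * q66 p

/-- The transverse polarization `f = (1 - (e₃·n)²)^{-1/2} e₃ × n`. -/
def transversePol (n : Fin 3 → ℝ) : Fin 3 → ℝ :=
  (Real.sqrt (1 - (e₃ ⬝ᵥ n) ^ 2))⁻¹ • crossProduct e₃ n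

/-- The block diagonal `3 × 3` matrix with a `2 × 2` block `B` and a `1 × 1` block `b`. -/
def blockDiag {R : Type} [Zero R] (B : Matrix (Fin 2) (Fin 2) R) (b : R) :
    Matrix (Fin 3) (Fin 3) R :=
  !![B 0 0, B 0 1, 0;
     B 1 0, B 1 1, 0;
     0, 0, b]

/-- The complexification of a real matrix. -/
def toC {m : ℕ} (A : Matrix (Fin m) (Fin m) ℝ) : Matrix (Fin m) (Fin m) ℂ :=
  A.map fun x : ℝ => (x : ℂ)

end Viscoelastic

end

open Viscoelastic

/-!
The wave-number matrix `K_n(p) = ρ^{1/2} p Q_n(p)^{-1/2}` has to be continued from `]0, ∞[` to the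
cut plane, with control of the Hermitian imaginary and real parts of the continuation. Everything
follows from one geometric fact: for `z` in the cut plane the numerical range of `Q_n(z)` lies in
the sector spanned by `1` and `z`, that is, `v† Q_n(z) v = α + β z` with `α > 0`, `β ≥ 0`
whenever `v ≠ 0` (`IsSectorial`).

*The sector.* By Bernstein's theorem a completely monotonic function is a mixture of exponentials
`exp (-r t)`, so `p` times its Laplace transform is a mixture of the functions `p / (p + r)`, which
continue to the cut plane with values in the sector. The form of Bernstein's theorem needed here is
`IsCM.exists_measure`. The Taylor series of `f` at a far point `T` has nonnegative coefficients in
powers of `1 - x / T`, and `(1 - x / T)^k` is close to `exp (-k x / T)`; hence `f` is a limit of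
exponential sums with nonnegative coefficients and bounded total mass
(`IsCM.exists_expSum_tendsto`), and a weak limit of the corresponding measures on the compactified
half-line of rates exists by compactness. A positive definite limit of the modulus at infinity makes
`α` positive. This is applied to `t ↦ ⟨E, G(t) E⟩` with `E` the symmetric part of `a ⊗ n`; the
entries of `Q_n` are recovered by polarization (`IsSolidModulus.exists_continuation_matrixQ`).

*The square root.* The inverse square root is represented by
`A^{-1/2} = (2 / π) ∫ (sin² θ + cos² θ A)⁻¹ dθ` over `[0, π / 2]` (`invSqrt`). The integrand is
jointly continuous on a compact interval and the matrices `sin² θ + cos² θ Q_n(z)` are again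
sectorial, hence invertible, so the integral is holomorphic in `z`. If `A` is sectorial and
`w = A⁻¹ v`, then `v† z A⁻¹ v = z conj (w† A w) = α z + β |z|²`, whose imaginary part has the
sign of `Im z` and whose real part is nonnegative if `Re z ≥ 0`. Integration gives the same for
`K_n(z)` (`IsSolidModulus.exists_continuation_matrixK`). For `z = p > 0` the integral agrees with
the functional calculus, because both act alike on eigenvectors (`toC_inv_cfc_sqrt`). Since `Q_n(p)` is
bounded below by the equilibrium response, `K_n(p) → 0` as `p → 0`.

*The transverse mode.* A constant eigenvector `f` has the eigenvalue `f · K_n(p) f`, which inherits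
the complete Bernstein property. The symmetry of `K_n` and the eigenvector equation persist on the
cut plane by the identity theorem, so `K_n(z)` is block diagonal in coordinates in which `f` is the
third axis, and so is its exponential. The phase speed is positive because the imaginary part of
`K_n` is definite off the real axis.
-/

noncomputable section

namespace Viscoelastic

/-! ### Completely monotonic functions as limits of exponential sums -/

namespace IsCM

variable {f : ℝ → ℝ}

lemma contDiffAt (hf : IsCM f) {t : ℝ} (ht : 0 < t) : ContDiffAt ℝ ∞ f t :=
  hf.1.contDiffAt (Ioi_mem_nhds ht)

lemma continuousOn (hf : IsCM f) : ContinuousOn f (Ioi 0) := hf.1.continuousOn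

lemma nonneg (hf : IsCM f) {t : ℝ} (ht : 0 < t) : 0 ≤ f t := by
  simpa using hf.2 0 t ht

lemma antitoneOn (hf : IsCM f) : AntitoneOn f (Ioi 0) := by
  refine antitoneOn_of_deriv_nonpos (convex_Ioi 0) hf.continuousOn ?_ ?_
  · rw [interior_Ioi]
    exact hf.1.differentiableOn (by simp)
  · intro x hx
    rw [interior_Ioi] at hx
    have := hf.2 1 x hx
    rw [iteratedDeriv_one] at this
    linarith

lemma continuousOn_iteratedDeriv (hf : IsCM f) (n : ℕ) :
    ContinuousOn (iteratedDeriv n f) (Ioi 0) :=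
  (hf.1.continuousOn_iteratedDerivWithin (m := n) (by exact_mod_cast le_top)
    isOpen_Ioi.uniqueDiffOn).congr fun _ hx => (iteratedDerivWithin_of_isOpen isOpen_Ioi hx).symm

/-- The Taylor coefficients of `f` at `T`, in powers of `1 - x / T`; they are nonnegative. -/
def taylorMass (f : ℝ → ℝ) (T : ℝ) (k : ℕ) : ℝ :=
  (-1) ^ k * iteratedDeriv k f T * T ^ k / k.factorial

lemma taylorMass_nonneg (hf : IsCM f) {T : ℝ} (hT : 0 < T) (k : ℕ) : 0 ≤ taylorMass f T k := by
  have := hf.2 k T hT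
  unfold taylorMass
  positivity

/-- The integral remainder of the Taylor expansion of `f` at `T`. -/
def taylorRem (f : ℝ → ℝ) (T : ℝ) (n : ℕ) (x : ℝ) : ℝ :=
  ∫ t in x..T, (t - x) ^ n / n.factorial * ((-1) ^ (n + 1) * iteratedDeriv (n + 1) f t)

lemma taylor_eq (hf : IsCM f) {T x : ℝ} (hx : 0 < x) (hxT : x ≤ T) (n : ℕ) :
    f x = (∑ k ∈ Finset.range (n + 1), taylorMass f T k * (1 - x / T) ^ k) +
      taylorRem f T n x := by
  have hT : 0 < T := hx.trans_le hxT
  rcases hxT.eq_or_lt with rfl | hlt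
  · simp [taylorRem, Finset.sum_range_succ', taylorMass, div_self hT.ne']
  have hsub : uIcc T x ⊆ Ioi 0 := by
    intro t ht
    rw [uIcc_of_ge hxT] at ht
    exact hx.trans_le ht.1
  have hu : UniqueDiffOn ℝ (uIcc T x) := uniqueDiffOn_uIcc hlt.ne'
  have hD : ∀ k, ∀ t ∈ uIcc T x, iteratedDerivWithin k f (uIcc T x) t = iteratedDeriv k f t :=
    fun k t ht => iteratedDerivWithin_eq_iteratedDeriv hu
      ((hf.contDiffAt (hsub ht)).of_le (by exact_mod_cast le_top)) ht
  have key := taylor_integral_remainder (f := f) (x := x) (x₀ := T) (n := n)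
    ((hf.1.of_le (by exact_mod_cast le_top)).mono hsub)
  rw [taylor_within_apply, sub_eq_iff_eq_add'] at key
  rw [key]
  congr 1
  · refine Finset.sum_congr rfl fun k _ => ?_
    rw [hD k T left_mem_uIcc, taylorMass, smul_eq_mul,
      show (1 - x / T) = (-1) * (x - T) / T by field_simp; ring, div_pow, mul_pow]
    have : ((-1 : ℝ) ^ k) * (-1) ^ k = 1 := by rw [← mul_pow]; simp
    field_simp
    linear_combination (-(x - T) ^ k * iteratedDeriv k f T) * this
  · rw [intervalIntegral.integral_symm, taylorRem, ← intervalIntegral.integral_neg]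
    refine intervalIntegral.integral_congr fun t ht => ?_
    rw [uIcc_comm] at ht
    simp only [hD _ t ht, smul_eq_mul]
    rw [show x - t = (-1) * (t - x) by ring, mul_pow, pow_succ]
    ring

lemma intervalIntegrable_taylorRem (hf : IsCM f) {T x y : ℝ} (hx : 0 < x) (hxT : x ≤ T) (n : ℕ) :
    IntervalIntegrable
      (fun t => (t - y) ^ n / n.factorial * ((-1) ^ (n + 1) * iteratedDeriv (n + 1) f t))
      volume x T := by
  apply ContinuousOn.intervalIntegrable
  have := (hf.continuousOn_iteratedDeriv (n + 1)).mono
    (show uIcc x T ⊆ Ioi 0 by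
      rw [uIcc_of_le hxT]; exact fun t ht => hx.trans_le ht.1)
  fun_prop

lemma taylorRem_nonneg (hf : IsCM f) {T x : ℝ} (hx : 0 < x) (hxT : x ≤ T) (n : ℕ) :
    0 ≤ taylorRem f T n x := by
  refine intervalIntegral.integral_nonneg hxT fun t ht => ?_
  have := hf.2 (n + 1) t (hx.trans_le ht.1)
  have := sub_nonneg.2 ht.1
  positivity

/-- The quotient of the weights `(t - x)ⁿ` and `(t - y)ⁿ` of two Taylor remainders is largest at
the endpoint `t = T`. -/
lemma taylorRem_le (hf : IsCM f) {T x y : ℝ} (hy : 0 < y) (hyx : y < x) (hxT : x ≤ T) (n : ℕ) :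
    taylorRem f T n x ≤ ((T - x) / (T - y)) ^ n * taylorRem f T n y := by
  have hx := hy.trans hyx
  have hTy : 0 < T - y := by linarith
  have h1 : taylorRem f T n x ≤ ((T - x) / (T - y)) ^ n *
      ∫ t in x..T, (t - y) ^ n / n.factorial * ((-1) ^ (n + 1) * iteratedDeriv (n + 1) f t) := by
    rw [← intervalIntegral.integral_const_mul]
    refine intervalIntegral.integral_mono_on hxT (hf.intervalIntegrable_taylorRem hx hxT n)
      ((hf.intervalIntegrable_taylorRem hx hxT n).const_mul _) fun t ht => ?_
    have h0 := hf.2 (n + 1) t (hx.trans_le ht.1)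
    rw [show ∀ A : ℝ, ((T - x) / (T - y)) ^ n * ((t - y) ^ n / n.factorial * A) =
      ((T - x) / (T - y) * (t - y)) ^ n / n.factorial * A by intro A; rw [mul_pow]; ring]
    have : t - x ≤ (T - x) / (T - y) * (t - y) := by
      rw [div_mul_eq_mul_div, le_div_iff₀ hTy]
      nlinarith [ht.1, ht.2, mul_nonneg (sub_nonneg.2 ht.2) (sub_nonneg.2 hyx.le)]
    have h2 := sub_nonneg.2 ht.1
    gcongr
  refine h1.trans ?_
  have h3 : 0 ≤ (T - x) / (T - y) := div_nonneg (by linarith) hTy.le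
  refine mul_le_mul_of_nonneg_left ?_ (pow_nonneg h3 n)
  refine intervalIntegral.integral_mono_interval hyx.le hxT le_rfl ?_
    (hf.intervalIntegrable_taylorRem hy (hyx.le.trans hxT) n)
  refine (ae_restrict_iff' measurableSet_Ioc).2 (.of_forall fun t ht => ?_)
  have := hf.2 (n + 1) t (hy.trans ht.1)
  have := sub_nonneg.2 ht.1.le
  simp only [Pi.zero_apply]
  positivity

/-- A completely monotonic function is the sum of its Taylor series at `T`, uniformly on compact
subintervals of `]0, T]`. -/
lemma exists_taylorRem_le (hf : IsCM f) {T x₀ ε : ℝ} (hx₀ : 0 < x₀) (hT : x₀ < T) (hε : 0 < ε) :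
    ∃ n, ∀ x ∈ Icc x₀ T, taylorRem f T n x ≤ ε := by
  have hy : 0 < x₀ / 2 := by positivity
  set y := x₀ / 2 with hyd
  set q := (T - x₀) / (T - y)
  have hTy : 0 < T - y := by linarith
  have hq0 : 0 ≤ q := div_nonneg (by linarith) hTy.le
  have hq1 : q < 1 := by rw [div_lt_one hTy]; linarith
  have hfy := hf.nonneg hy
  -- the remainder at `x` is at most `q ^ n` times the one at `y`, and the latter is at most `f y`
  obtain ⟨n, hn⟩ := exists_pow_lt_of_lt_one (show 0 < ε / (f y + 1) by positivity) hq1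
  refine ⟨n, fun x hx => ?_⟩
  have hR : taylorRem f T n y ≤ f y := by
    have h1 := hf.taylor_eq hy (show y ≤ T by linarith) n
    have h2 : 0 ≤ ∑ k ∈ Finset.range (n + 1), taylorMass f T k * (1 - y / T) ^ k := by
      refine Finset.sum_nonneg fun k _ => mul_nonneg (hf.taylorMass_nonneg (by linarith) k)
        (pow_nonneg (sub_nonneg.2 ((div_le_one (by linarith)).2 (by linarith))) k)
    linarith
  calc taylorRem f T n x ≤ ((T - x) / (T - y)) ^ n * taylorRem f T n y :=
        hf.taylorRem_le hy (by linarith [hx.1]) hx.2 n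
    _ ≤ q ^ n * f y := by
        have := hf.taylorRem_nonneg hy (show y ≤ T by linarith) n
        have h4 : 0 ≤ (T - x) / (T - y) := div_nonneg (by linarith [hx.2]) hTy.le
        have h5 : (T - x) / (T - y) ≤ q := by
          simp only [q]; gcongr; exact hx.1
        gcongr
    _ ≤ ε / (f y + 1) * (f y + 1) := by gcongr; linarith
    _ = ε := by field_simp

/-- A completely monotonic function bounded by `C` is the pointwise limit of exponential sums with
nonnegative coefficients of total mass at most `C`. -/
theorem exists_expSum_tendsto (hf : IsCM f) {C : ℝ} (hC : ∀ t, 0 < t → f t ≤ C) :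
    ∃ (n : ℕ → ℕ) (m r : ℕ → ℕ → ℝ), (∀ N k, 0 ≤ m N k) ∧ (∀ N k, 0 ≤ r N k) ∧
      (∀ N, ∑ k ∈ Finset.range (n N), m N k ≤ C) ∧
      ∀ x, 0 < x → Tendsto (fun N => ∑ k ∈ Finset.range (n N), m N k * Real.exp (-r N k * x))
        atTop (𝓝 (f x)) := by
  have hN2 : ∀ N : ℕ, (0 : ℝ) < N + 2 := fun N => by positivity
  have hN1 : ∀ N : ℕ, ((N : ℝ) + 2)⁻¹ < N + 2 := fun N => by
    have : ((N : ℝ) + 2)⁻¹ ≤ 1 := inv_le_one_of_one_le₀ (by linarith [N.cast_nonneg (α := ℝ)])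
    linarith [N.cast_nonneg (α := ℝ)]
  have H : ∀ N : ℕ, ∃ n, ∀ x ∈ Icc (((N : ℝ) + 2)⁻¹) (N + 2),
      taylorRem f (N + 2) n x ≤ ((N : ℝ) + 2)⁻¹ :=
    fun N => hf.exists_taylorRem_le (inv_pos.2 (hN2 N)) (hN1 N) (inv_pos.2 (hN2 N))
  choose n hn using H
  have hupper : ∀ N : ℕ, ∀ x : ℝ, 0 < x → x ≤ N + 2 →
      ∑ k ∈ Finset.range (n N + 1), taylorMass f (N + 2) k * (1 - x / (N + 2)) ^ k ≤ f x := by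
    intro N x hx hxT
    rw [hf.taylor_eq hx hxT (n N)]
    linarith [hf.taylorRem_nonneg hx hxT (n N)]
  refine ⟨fun N => n N + 1, fun N k => taylorMass f (N + 2) k, fun N k => k / (N + 2),
    fun N k => hf.taylorMass_nonneg (hN2 N) k, fun N k => by positivity, fun N => ?_,
    fun x hx => ?_⟩
  · -- let `x → 0` in the Taylor sum
    have hlim : Tendsto (fun x : ℝ =>
        ∑ k ∈ Finset.range (n N + 1), taylorMass f (N + 2) k * (1 - x / (N + 2)) ^ k) (𝓝[>] 0)
        (𝓝 (∑ k ∈ Finset.range (n N + 1), taylorMass f (N + 2) k * (1 - 0 / (N + 2)) ^ k)) := by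
      refine (Continuous.tendsto ?_ 0).mono_left nhdsWithin_le_nhds
      fun_prop
    simp only [zero_div, sub_zero, one_pow, mul_one] at hlim
    refine le_of_tendsto hlim ?_
    filter_upwards [Ioo_mem_nhdsGT (hN2 N)] with x hx
    exact (hupper N x hx.1 hx.2.le).trans (hC x hx.1)
  · -- squeeze between `f x - 1 / (N + 2)` and `f y`, where `1 - y / T = (1 + x / T)⁻¹`
    have hTtop : Tendsto (fun N : ℕ => (N : ℝ) + 2) atTop atTop :=
      tendsto_atTop_add_const_right _ _ tendsto_natCast_atTop_atTop
    have hTinv : Tendsto (fun N : ℕ => ((N : ℝ) + 2)⁻¹) atTop (𝓝 0) :=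
      tendsto_inv_atTop_zero.comp hTtop
    have hlow : Tendsto (fun N : ℕ => f x - ((N : ℝ) + 2)⁻¹) atTop (𝓝 (f x)) := by
      simpa using tendsto_const_nhds.sub hTinv
    have hup : Tendsto (fun N : ℕ => f (x / (1 + x * ((N : ℝ) + 2)⁻¹))) atTop (𝓝 (f x)) := by
      have h1 : Tendsto (fun N : ℕ => x / (1 + x * ((N : ℝ) + 2)⁻¹)) atTop (𝓝 x) := by
        have := (tendsto_const_nhds (x := x)).div
          ((tendsto_const_nhds (x := (1 : ℝ))).add ((tendsto_const_nhds (x := x)).mul hTinv))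
          (by simp)
        simpa [Pi.div_def] using this
      exact ((hf.contDiffAt hx).continuousAt.tendsto).comp h1
    refine tendsto_of_tendsto_of_tendsto_of_le_of_le' hlow hup ?_ ?_
    · filter_upwards [hTtop.eventually_ge_atTop x, hTinv.eventually_le_const hx] with N h1 h2
      have h3 := hn N x ⟨h2, h1⟩
      have h4 := hf.taylor_eq hx h1 (n N)
      have h5 : ∑ k ∈ Finset.range (n N + 1), taylorMass f (N + 2) k * (1 - x / (N + 2)) ^ k ≤
          ∑ k ∈ Finset.range (n N + 1), taylorMass f (N + 2) k *
            Real.exp (-(k / ((N : ℝ) + 2)) * x) := by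
        refine Finset.sum_le_sum fun k _ =>
          mul_le_mul_of_nonneg_left ?_ (hf.taylorMass_nonneg (hN2 N) k)
        rw [show -((k : ℝ) / (N + 2)) * x = k * (-(x / (N + 2))) by ring, Real.exp_nat_mul]
        exact pow_le_pow_left₀ (sub_nonneg.2 ((div_le_one (hN2 N)).2 h1))
          (Real.one_sub_le_exp_neg _) k
      linarith
    · filter_upwards with N
      have hT := hN2 N
      set u := x * ((N : ℝ) + 2)⁻¹ with hu
      have hu0 : 0 < 1 + u := by positivity
      have hy : 1 - x / (1 + u) / (N + 2) = (1 + u)⁻¹ := by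
        rw [div_right_comm, div_eq_mul_inv x, ← hu]
        field_simp
        ring
      have hyT : x / (1 + u) ≤ N + 2 := by
        have : 0 ≤ 1 - x / (1 + u) / (N + 2) := hy ▸ (inv_pos.2 hu0).le
        exact (div_le_one hT).1 (sub_nonneg.1 this)
      refine le_trans ?_ (hupper N (x / (1 + u)) (by positivity) hyT)
      refine Finset.sum_le_sum fun k _ =>
        mul_le_mul_of_nonneg_left ?_ (hf.taylorMass_nonneg hT k)
      rw [hy, show -((k : ℝ) / (N + 2)) * x = k * (-u) by rw [hu]; ring, Real.exp_nat_mul,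
        Real.exp_neg]
      refine pow_le_pow_left₀ (by positivity) (inv_anti₀ hu0 ?_) k
      linarith [Real.add_one_le_exp u]

end IsCM

/-! ### Continuation of the Laplace transform of a completely monotonic function -/

/-- An integral over a compact set of a jointly continuous function that is holomorphic in the
parameter is holomorphic in the parameter; the derivative is dominated by Cauchy's estimate. -/
theorem differentiableOn_setIntegral {X : Type*} [TopologicalSpace X] [T2Space X]
    [SecondCountableTopology X] [MeasurableSpace X] [BorelSpace X] {μ : Measure X}
    [IsFiniteMeasureOnCompacts μ] {K : Set X} (hK : IsCompact K) {U : Set ℂ} (hU : IsOpen U)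
    {φ : ℂ → X → ℂ} (hc : ContinuousOn (Function.uncurry φ) (U ×ˢ K))
    (hd : ∀ x ∈ K, DifferentiableOn ℂ (fun z => φ z x) U) :
    DifferentiableOn ℂ (fun z => ∫ x in K, φ z x ∂μ) U := by
  intro z₀ hz₀
  obtain ⟨r, hr, hrU⟩ : ∃ r > 0, Metric.closedBall z₀ (2 * r) ⊆ U := by
    obtain ⟨ε, hε, h⟩ := Metric.nhds_basis_closedBall.mem_iff.1 (hU.mem_nhds hz₀)
    exact ⟨ε / 2, by positivity, by rwa [mul_div_cancel₀ _ two_ne_zero]⟩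
  obtain ⟨B, hB⟩ := ((isCompact_closedBall z₀ (2 * r)).prod hK).exists_bound_of_continuousOn
    (hc.mono (prod_mono hrU subset_rfl))
  have hcK : ∀ z ∈ U, ContinuousOn (φ z) K := fun z hz =>
    hc.comp (by fun_prop : ContinuousOn (fun x => (z, x)) K) fun x hx => ⟨hz, hx⟩
  have hmeas : ∀ z ∈ U, AEStronglyMeasurable (φ z) (μ.restrict K) := fun z hz =>
    (hcK z hz).aestronglyMeasurable hK.measurableSet
  have hball : ∀ z ∈ Metric.ball z₀ r, Metric.closedBall z r ⊆ Metric.closedBall z₀ (2 * r) :=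
    fun z hz => Metric.closedBall_subset_closedBall' (by
      have := Metric.mem_ball.1 hz
      linarith)
  have hderiv : ∀ x ∈ K, ∀ z ∈ U, HasDerivAt (fun z => φ z x) (deriv (fun z => φ z x) z) z :=
    fun x hx z hz => ((hd x hx).differentiableAt (hU.mem_nhds hz)).hasDerivAt
  refine (hasDerivAt_integral_of_dominated_loc_of_deriv_le (F := φ) (𝕜 := ℂ)
    (F' := fun z x => deriv (fun z => φ z x) z) (bound := fun _ => B / r)
    (Metric.ball_mem_nhds z₀ hr) ?_ ?_ ?_ ?_ ?_ ?_).2.differentiableAt.differentiableWithinAt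
  · filter_upwards [hU.mem_nhds hz₀] with z hz using hmeas z hz
  · exact (hcK z₀ hz₀).integrableOn_compact hK
  · -- the derivative is the pointwise limit of difference quotients
    have hseq : Tendsto (fun n : ℕ => z₀ + ((r / (n + 1) : ℝ) : ℂ)) atTop (𝓝[≠] z₀) := by
      refine tendsto_nhdsWithin_iff.2 ⟨?_, .of_forall fun n => ?_⟩
      · have h1 : Tendsto (fun n : ℕ => r / ((n : ℝ) + 1)) atTop (𝓝 0) :=
          tendsto_const_nhds.div_atTop
            (tendsto_atTop_add_const_right _ _ tendsto_natCast_atTop_atTop)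
        have h2 := ((Complex.continuous_ofReal.tendsto 0).comp h1).const_add z₀
        simpa [Function.comp_def] using h2
      · have : ((r / (n + 1) : ℝ) : ℂ) ≠ 0 := by
          rw [Complex.ofReal_ne_zero]; positivity
        simpa using this
    refine aestronglyMeasurable_of_tendsto_ae atTop
      (f := fun (n : ℕ) x => slope (fun z => φ z x) z₀ (z₀ + ((r / (n + 1) : ℝ) : ℂ))) ?_ ?_
    · intro n
      have hn : z₀ + ((r / (n + 1) : ℝ) : ℂ) ∈ U := by
        apply hrU
        rw [Metric.mem_closedBall, dist_self_add_left, Complex.norm_real, Real.norm_eq_abs,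
          abs_of_pos (by positivity)]
        have : r / ((n : ℝ) + 1) ≤ r := div_le_self hr.le (by linarith [n.cast_nonneg (α := ℝ)])
        linarith
      exact ((hmeas _ hn).sub (hmeas _ hz₀)).const_mul (z₀ + ((r / (n + 1) : ℝ) : ℂ) - z₀)⁻¹
    · refine (ae_restrict_iff' hK.measurableSet).2 (.of_forall fun x hx => ?_)
      exact (hasDerivAt_iff_tendsto_slope.1 (hderiv x hx z₀ hz₀)).comp hseq
  · refine (ae_restrict_iff' hK.measurableSet).2 (.of_forall fun x hx z hz => ?_)
    refine Complex.norm_deriv_le_of_forall_mem_sphere_norm_le hr ?_ fun w hw =>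
      hB (w, x) ⟨hball z hz (Metric.sphere_subset_closedBall hw), hx⟩
    refine DifferentiableOn.diffContOnCl ?_
    rw [closure_ball z hr.ne']
    exact (hd x hx).mono ((hball z hz).trans hrU)
  · have : IsFiniteMeasure (μ.restrict K) := ⟨by simpa using hK.measure_lt_top⟩
    exact integrable_const _
  · refine (ae_restrict_iff' hK.measurableSet).2 (.of_forall fun x hx z hz => ?_)
    exact hderiv x hx z (hrU (hball z hz (Metric.mem_closedBall_self hr.le)))

/-- The function `z / (z + r)`, the value at `z` of `z` times the Laplace transform of
`exp (-r t)`, with `r ∈ [0, ∞]` parametrized as `r = s / (1 - s)`, `s ∈ [0, 1]`. -/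
def relaxKernel (z : ℂ) (s : unitInterval) : ℂ :=
  z * (1 - (s : ℝ)) / (z * (1 - (s : ℝ)) + (s : ℝ))

lemma relaxKernel_denom_mem {z : ℂ} (hz : z ∈ Complex.slitPlane) (s : unitInterval) :
    z * (1 - (s : ℝ)) + (s : ℝ) ∈ Complex.slitPlane := by
  have := Complex.starConvex_one_slitPlane hz s.2.1 (sub_nonneg.2 s.2.2)
    (add_sub_cancel _ _)
  convert this using 1
  simp
  ring

lemma relaxKernel_denom_ne {z : ℂ} (hz : z ∈ Complex.slitPlane) (s : unitInterval) :
    z * (1 - (s : ℝ)) + (s : ℝ) ≠ 0 :=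
  Complex.slitPlane_ne_zero (relaxKernel_denom_mem hz s)

lemma continuousOn_relaxKernel :
    ContinuousOn (Function.uncurry relaxKernel) (Complex.slitPlane ×ˢ univ) := by
  unfold relaxKernel Function.uncurry
  refine ContinuousOn.div (by fun_prop) (by fun_prop) fun x hx => relaxKernel_denom_ne hx.1 x.2

lemma continuous_relaxKernel {z : ℂ} (hz : z ∈ Complex.slitPlane) :
    Continuous (relaxKernel z) := by
  unfold relaxKernel
  exact Continuous.div (by fun_prop) (by fun_prop) fun s => relaxKernel_denom_ne hz s

/-- The values of `relaxKernel z` lie in the sector spanned by `1` and `z`. -/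
lemma relaxKernel_eq {z : ℂ} (hz : z ∈ Complex.slitPlane) (s : unitInterval) :
    relaxKernel z s =
      ((Complex.normSq z * (1 - (s : ℝ)) ^ 2 /
        Complex.normSq (z * (1 - (s : ℝ)) + (s : ℝ)) : ℝ) : ℂ) +
      (((1 - (s : ℝ)) * s / Complex.normSq (z * (1 - (s : ℝ)) + (s : ℝ)) : ℝ) : ℂ) * z := by
  have h := relaxKernel_denom_ne hz s
  have h' : (Complex.normSq (z * (1 - (s : ℝ)) + (s : ℝ)) : ℂ) ≠ 0 := by
    simpa using h
  have h2 := Complex.mul_conj (z * (1 - (s : ℝ)) + (s : ℝ))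
  have h3 := Complex.mul_conj z
  unfold relaxKernel
  push_cast
  rw [div_mul_eq_mul_div, ← add_div, div_eq_div_iff h h', ← h2, ← h3]
  simp
  ring

lemma ofReal_mem_slitPlane {p : ℝ} (hp : 0 < p) : (p : ℂ) ∈ Complex.slitPlane := Or.inl hp

/-- `s = r / (1 + r)`, the point of `[0, 1]` that stands for the relaxation rate `r`. -/
def ratePoint (r : ℝ) (hr : 0 ≤ r) : unitInterval :=
  ⟨r / (1 + r), div_nonneg hr (by linarith), (div_le_one (by linarith)).2 (by linarith)⟩

lemma relaxKernel_ratePoint {p r : ℝ} (hp : 0 < p) (hr : 0 ≤ r) :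
    relaxKernel p (ratePoint r hr) = ((p / (p + r) : ℝ) : ℂ) := by
  have h1 : 1 + r ≠ 0 := by positivity
  have h2 : p + r ≠ 0 := by positivity
  have : (p * (1 - r / (1 + r)) / (p * (1 - r / (1 + r)) + r / (1 + r)) : ℝ) = p / (p + r) := by
    rw [show 1 - r / (1 + r) = 1 / (1 + r) by field_simp; ring]
    field_simp
  rw [← this, relaxKernel, ratePoint]
  push_cast
  rfl

/-- The Laplace transform of an exponential sum. -/
lemma integral_exp_mul_expSum {p : ℝ} (hp : 0 < p) (n : ℕ) (m r : ℕ → ℝ) (hr : ∀ k, 0 ≤ r k) :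
    p * ∫ t in Ioi (0 : ℝ), Real.exp (-p * t) *
      ∑ k ∈ Finset.range n, m k * Real.exp (-r k * t) =
      ∑ k ∈ Finset.range n, m k * (p / (p + r k)) := by
  have hneg : ∀ k, -(p + r k) < 0 := fun k => by linarith [hr k]
  have h1 : ∀ t, Real.exp (-p * t) * ∑ k ∈ Finset.range n, m k * Real.exp (-r k * t) =
      ∑ k ∈ Finset.range n, m k * Real.exp (-(p + r k) * t) := by
    intro t
    rw [Finset.mul_sum]
    refine Finset.sum_congr rfl fun k _ => ?_
    rw [mul_left_comm, ← Real.exp_add]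
    ring_nf
  simp only [h1]
  rw [integral_finsetSum _ fun k _ => (integrableOn_exp_mul_Ioi (hneg k) 0).const_mul (m k),
    Finset.mul_sum]
  refine Finset.sum_congr rfl fun k _ => ?_
  rw [integral_const_mul, integral_exp_mul_Ioi (hneg k)]
  have : p + r k ≠ 0 := by linarith [hneg k]
  rw [mul_zero, Real.exp_zero, neg_div_neg_eq]
  field_simp

/-- **Bernstein's theorem** for bounded functions, on the side of the Laplace transform: `p` times
the Laplace transform of a bounded completely monotonic function is a mixture of the functions
`p / (p + r)`, `r ∈ [0, ∞]`. The measure is a weak limit of the measures of exponential sums. -/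
theorem IsCM.exists_measure {f : ℝ → ℝ} (hf : IsCM f) {C : ℝ} (hC : ∀ t, 0 < t → f t ≤ C) :
    ∃ ν : FiniteMeasure unitInterval, ∀ p : ℝ, 0 < p →
      ((p * ∫ t in Ioi (0 : ℝ), Real.exp (-p * t) * f t : ℝ) : ℂ) =
        ∫ s, relaxKernel p s ∂(ν : Measure unitInterval) := by
  obtain ⟨n, m, r, hm, hr, hmC, hlim⟩ := hf.exists_expSum_tendsto hC
  let δ : unitInterval → FiniteMeasure unitInterval := fun s => ⟨Measure.dirac s, inferInstance⟩
  let μ : ℕ → FiniteMeasure unitInterval := fun N =>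
    ∑ k ∈ Finset.range (n N), (m N k).toNNReal • δ (ratePoint (r N k) (hr N k))
  have hμ : ∀ N, (μ N : Measure unitInterval) = ∑ k ∈ Finset.range (n N), (m N k).toNNReal •
      Measure.dirac (ratePoint (r N k) (hr N k)) := by
    intro N
    simp only [μ, FiniteMeasure.toMeasure_sum, FiniteMeasure.toMeasure_smul]
    rfl
  have hmass : ∀ N, (μ N).mass ≤ C.toNNReal := by
    intro N
    have : (μ N).mass = (∑ k ∈ Finset.range (n N), m N k).toNNReal := by
      rw [← ENNReal.coe_inj, FiniteMeasure.ennreal_mass, hμ,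
        Real.toNNReal_sum_of_nonneg fun k _ => hm N k]
      simp
    rw [this]
    exact Real.toNNReal_le_toNNReal (hmC N)
  obtain ⟨ν, -, hν⟩ := (isCompact_setOfPred_finiteMeasure_le_of_compactSpace unitInterval
    C.toNNReal).ultrafilter_le_nhds ((hyperfilter ℕ).map μ) (by
      rw [le_principal_iff]
      exact Filter.mem_map.2 (Filter.univ_mem' hmass))
  refine ⟨ν, fun p hp => ?_⟩
  have h1 : Tendsto (fun N => ∫ s, relaxKernel p s ∂(μ N : Measure unitInterval)) (hyperfilter ℕ)
      (𝓝 (∫ s, relaxKernel p s ∂(ν : Measure unitInterval))) :=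
    (FiniteMeasure.tendsto_iff_forall_integral_rclike_tendsto ℂ).1 (show Tendsto μ _ _ from hν)
      (BoundedContinuousFunction.mkOfCompact
        ⟨_, continuous_relaxKernel (ofReal_mem_slitPlane hp)⟩)
  have h2 : ∀ N, ∫ s, relaxKernel p s ∂(μ N : Measure unitInterval) =
      ((p * ∫ t in Ioi (0 : ℝ), Real.exp (-p * t) *
        ∑ k ∈ Finset.range (n N), m N k * Real.exp (-r N k * t) : ℝ) : ℂ) := by
    intro N
    have hi : ∀ s : unitInterval, Integrable (relaxKernel p) (Measure.dirac s) := fun s =>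
      (BoundedContinuousFunction.mkOfCompact
        ⟨_, continuous_relaxKernel (ofReal_mem_slitPlane hp)⟩).integrable _
    rw [hμ, integral_finsetSum_measure fun k _ => (hi _).smul_measure_nnreal,
      integral_exp_mul_expSum hp _ _ _ (hr N)]
    push_cast
    refine Finset.sum_congr rfl fun k _ => ?_
    rw [integral_smul_nnreal_measure, integral_dirac, relaxKernel_ratePoint hp,
      NNReal.smul_def, Real.coe_toNNReal _ (hm N k)]
    simp
  have h3 : Tendsto (fun N => ((p * ∫ t in Ioi (0 : ℝ), Real.exp (-p * t) *
        ∑ k ∈ Finset.range (n N), m N k * Real.exp (-r N k * t) : ℝ) : ℂ)) atTop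
      (𝓝 ((p * ∫ t in Ioi (0 : ℝ), Real.exp (-p * t) * f t : ℝ) : ℂ)) := by
    refine (Complex.continuous_ofReal.tendsto _).comp (Tendsto.const_mul _ ?_)
    refine tendsto_integral_of_dominated_convergence (fun t => Real.exp (-p * t) * C) ?_ ?_ ?_ ?_
    · intro N
      refine Continuous.aestronglyMeasurable ?_
      fun_prop
    · exact (integrableOn_exp_mul_Ioi (neg_lt_zero.2 hp) 0).mul_const C
    · refine fun N => (ae_restrict_iff' measurableSet_Ioi).2 (.of_forall fun t ht => ?_)
      have h0 : 0 ≤ ∑ k ∈ Finset.range (n N), m N k * Real.exp (-r N k * t) :=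
        Finset.sum_nonneg fun k _ => mul_nonneg (hm N k) (Real.exp_nonneg _)
      rw [Real.norm_of_nonneg (mul_nonneg (Real.exp_nonneg _) h0)]
      refine mul_le_mul_of_nonneg_left (le_trans (Finset.sum_le_sum fun k _ => ?_) (hmC N))
        (Real.exp_nonneg _)
      refine mul_le_of_le_one_right (hm N k) (Real.exp_le_one_iff.2 ?_)
      nlinarith [hr N k, mem_Ioi.1 ht]
    · refine (ae_restrict_iff' measurableSet_Ioi).2 (.of_forall fun t ht => ?_)
      exact (hlim t ht).const_mul _
  refine tendsto_nhds_unique (h3.mono_left (Nat.hyperfilter_le_atTop)) ?_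
  simpa only [h2] using h1

lemma IsCM.sub_const {f : ℝ → ℝ} (hf : IsCM f) {l : ℝ} (hl : ∀ t, 0 < t → l ≤ f t) :
    IsCM fun t => f t - l := by
  refine ⟨hf.1.sub contDiffOn_const, fun n t ht => ?_⟩
  rcases n with _ | n
  · simpa using hl t ht
  · have : iteratedDeriv (n + 1) (fun t => f t - l) = iteratedDeriv (n + 1) f := by
      rw [iteratedDeriv_succ', iteratedDeriv_succ']
      congr 1
      ext x
      simp
    rw [this]
    exact hf.2 _ t ht

lemma IsCM.le_of_tendsto_atTop {f : ℝ → ℝ} (hf : IsCM f) {l : ℝ} (hl : Tendsto f atTop (𝓝 l))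
    {t : ℝ} (ht : 0 < t) : l ≤ f t := by
  refine le_of_tendsto hl ?_
  filter_upwards [eventually_ge_atTop t] with s hs
  exact hf.antitoneOn ht (ht.trans_le hs) hs

lemma IsCM.le_of_tendsto_zero {f : ℝ → ℝ} (hf : IsCM f) {L : ℝ} (hL : Tendsto f (𝓝[>] 0) (𝓝 L))
    {t : ℝ} (ht : 0 < t) : f t ≤ L := by
  refine ge_of_tendsto hL ?_
  filter_upwards [Ioo_mem_nhdsGT ht] with s hs
  exact hf.antitoneOn hs.1 ht hs.2.le

lemma IsCM.integrableOn_exp_mul {f : ℝ → ℝ} (hf : IsCM f) {C : ℝ} (hC : ∀ t, 0 < t → f t ≤ C)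
    {p : ℝ} (hp : 0 < p) : IntegrableOn (fun t => Real.exp (-p * t) * f t) (Ioi 0) := by
  refine ((integrableOn_exp_mul_Ioi (neg_lt_zero.2 hp) 0).mul_const C).mono' ?_ ?_
  · refine ContinuousOn.aestronglyMeasurable ?_ measurableSet_Ioi
    have := hf.continuousOn
    fun_prop
  · refine (ae_restrict_iff' measurableSet_Ioi).2 (.of_forall fun t ht => ?_)
    rw [Real.norm_of_nonneg (mul_nonneg (Real.exp_nonneg _) (hf.nonneg ht))]
    exact mul_le_mul_of_nonneg_left (hC t ht) (Real.exp_nonneg _)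

/-- `p` times the Laplace transform of a completely monotonic function with finite limits continues
to the cut plane, and the values of the continuation at `z` lie in the sector spanned by `1` and
`z`. -/
theorem IsCM.exists_continuation {f : ℝ → ℝ} (hf : IsCM f) {L l : ℝ}
    (hL : Tendsto f (𝓝[>] 0) (𝓝 L)) (hl : Tendsto f atTop (𝓝 l)) :
    ∃ F : ℂ → ℂ,
      IsContinuation (fun p => p * ∫ t in Ioi (0 : ℝ), Real.exp (-p * t) * f t) F ∧
      ∀ z ∈ Complex.slitPlane, ∃ α β : ℝ, l ≤ α ∧ 0 ≤ β ∧ F z = α + β * z := by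
  have hlf : ∀ t, 0 < t → l ≤ f t := fun t ht => hf.le_of_tendsto_atTop hl ht
  have hfL : ∀ t, 0 < t → f t ≤ L := fun t ht => hf.le_of_tendsto_zero hL ht
  obtain ⟨ν, hν⟩ := (hf.sub_const hlf).exists_measure (C := L - l)
    fun t ht => sub_le_sub_right (hfL t ht) l
  refine ⟨fun z => l + ∫ s, relaxKernel z s ∂(ν : Measure unitInterval), ⟨?_, ?_⟩, ?_⟩
  · refine DifferentiableOn.const_add _ ?_
    have := differentiableOn_setIntegral (μ := (ν : Measure unitInterval)) isCompact_univ
      Complex.isOpen_slitPlane continuousOn_relaxKernel (fun s _ => by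
        unfold relaxKernel
        exact DifferentiableOn.div (by fun_prop) (by fun_prop) fun z hz =>
          relaxKernel_denom_ne hz s)
    simpa using this
  · intro p hp
    simp only
    rw [← hν p hp]
    have h1 : ∫ t in Ioi (0 : ℝ), Real.exp (-p * t) * (f t - l) =
        (∫ t in Ioi (0 : ℝ), Real.exp (-p * t) * f t) - l / p := by
      simp only [mul_sub]
      rw [integral_sub (hf.integrableOn_exp_mul hfL hp)
        ((integrableOn_exp_mul_Ioi (neg_lt_zero.2 hp) 0).mul_const l), integral_mul_const,
        integral_exp_mul_Ioi (neg_lt_zero.2 hp)]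
      simp
      ring
    rw [h1, ← Complex.ofReal_add]
    congr 1
    field_simp
    ring
  · intro z hz
    have hD : Continuous fun s : unitInterval =>
        Complex.normSq (z * (1 - (s : ℝ)) + (s : ℝ)) :=
      Complex.continuous_normSq.comp (by fun_prop)
    have hD0 : ∀ s : unitInterval, Complex.normSq (z * (1 - (s : ℝ)) + (s : ℝ)) ≠ 0 := fun s =>
      (Complex.normSq_pos.2 (relaxKernel_denom_ne hz s)).ne'
    have hcα : Continuous fun s : unitInterval => Complex.normSq z * (1 - (s : ℝ)) ^ 2 /
        Complex.normSq (z * (1 - (s : ℝ)) + (s : ℝ)) := Continuous.div (by fun_prop) hD hD0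
    have hcβ : Continuous fun s : unitInterval => (1 - (s : ℝ)) * s /
        Complex.normSq (z * (1 - (s : ℝ)) + (s : ℝ)) := Continuous.div (by fun_prop) hD hD0
    have hint : ∀ {g : unitInterval → ℂ}, Continuous g → Integrable g (ν : Measure unitInterval) :=
      fun {g} hg => (BoundedContinuousFunction.mkOfCompact ⟨g, hg⟩).integrable _
    refine ⟨l + ∫ s : unitInterval, Complex.normSq z * (1 - (s : ℝ)) ^ 2 /
        Complex.normSq (z * (1 - (s : ℝ)) + (s : ℝ)) ∂(ν : Measure unitInterval),
      ∫ s : unitInterval, (1 - (s : ℝ)) * s /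
        Complex.normSq (z * (1 - (s : ℝ)) + (s : ℝ)) ∂(ν : Measure unitInterval), ?_, ?_, ?_⟩
    · refine le_add_of_nonneg_right (integral_nonneg fun s => ?_)
      have := Complex.normSq_nonneg z
      have := Complex.normSq_nonneg (z * (1 - (s : ℝ)) + (s : ℝ))
      positivity
    · refine integral_nonneg fun s => div_nonneg (mul_nonneg (sub_nonneg.2 s.2.2) s.2.1)
        (Complex.normSq_nonneg _)
    · simp only [relaxKernel_eq hz]
      have h1 := hint (Complex.continuous_ofReal.comp hcα)
      have h2 := hint ((Complex.continuous_ofReal.comp hcβ).mul (continuous_const (y := z)))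
      rw [integral_add (by exact h1) (by exact h2),
        integral_mul_const, integral_complex_ofReal, integral_complex_ofReal]
      push_cast
      ring

/-! ### The inverse square root of a sectorial matrix -/

lemma sin_sq_mul_add_pos {a b : ℝ} (ha : 0 < a) (hb : 0 < b) (θ : ℝ) :
    0 < Real.sin θ ^ 2 * a + Real.cos θ ^ 2 * b := by
  have hsc := Real.sin_sq_add_cos_sq θ
  rcases eq_or_ne (Real.sin θ) 0 with h | h
  · have : Real.cos θ ^ 2 = 1 := by rw [h] at hsc; linarith
    rw [h, this]; linarith
  · positivity

/-- A primitive of `1 / (sin² θ + b² cos² θ)`. On `[0, π / 2[` it is `arctan (tan θ / b) / b`,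
written so that it stays smooth at `π / 2`. -/
lemma hasDerivAt_arctan_primitive {b : ℝ} (hb : 0 < b) (θ : ℝ) :
    HasDerivAt (fun θ => (θ + Real.arctan ((1 - b) * (Real.sin θ * Real.cos θ) /
      (b * Real.cos θ ^ 2 + Real.sin θ ^ 2))) / b)
      (Real.sin θ ^ 2 + Real.cos θ ^ 2 * b ^ 2)⁻¹ θ := by
  have hsc := Real.sin_sq_add_cos_sq θ
  have hD : 0 < b * Real.cos θ ^ 2 + Real.sin θ ^ 2 := by
    linarith [sin_sq_mul_add_pos one_pos hb θ]
  have hE : 0 < Real.sin θ ^ 2 + Real.cos θ ^ 2 * b ^ 2 := by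
    simpa using sin_sq_mul_add_pos one_pos (pow_pos hb 2) θ
  have hs := Real.hasDerivAt_sin θ
  have hc := Real.hasDerivAt_cos θ
  have h1 := ((hs.mul hc).const_mul (1 - b)).div (((hc.pow 2).const_mul b).add (hs.pow 2)) hD.ne'
  have h2 := ((hasDerivAt_id θ).add h1.arctan).div_const b
  refine h2.congr_deriv ?_
  simp only [Pi.add_apply, Pi.mul_apply, Pi.pow_apply, Nat.cast_ofNat, Nat.add_one_sub_one,
    pow_one, Pi.div_apply]
  set s := Real.sin θ
  set c := Real.cos θ
  have hF : 0 < (b * c ^ 2 + s ^ 2) ^ 2 + ((1 - b) * (s * c)) ^ 2 := by positivity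
  have hFE : (b * c ^ 2 + s ^ 2) ^ 2 + ((1 - b) * (s * c)) ^ 2 = s ^ 2 + c ^ 2 * b ^ 2 := by
    linear_combination (s ^ 2 + c ^ 2 * b ^ 2) * hsc
  rw [div_pow, show (1 : ℝ) + ((1 - b) * (s * c)) ^ 2 / (b * c ^ 2 + s ^ 2) ^ 2 =
    (s ^ 2 + c ^ 2 * b ^ 2) / (b * c ^ 2 + s ^ 2) ^ 2 by rw [← hFE]; field_simp]
  have hD' : c ^ 2 * b + s ^ 2 ≠ 0 := by rw [mul_comm]; exact hD.ne'
  field_simp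
  linear_combination ((1 - b) * (b * c ^ 2 - s ^ 2) + b) * hsc

/-- The scalar case of the representation of the inverse square root. -/
lemma integral_inv_sin_sq_add {a : ℝ} (ha : 0 < a) :
    ∫ θ in (0 : ℝ)..(Real.pi / 2), (Real.sin θ ^ 2 + Real.cos θ ^ 2 * a)⁻¹ =
      Real.pi / 2 / Real.sqrt a := by
  obtain ⟨b, hb, rfl⟩ : ∃ b, 0 < b ∧ a = b ^ 2 :=
    ⟨_, Real.sqrt_pos.2 ha, (Real.sq_sqrt ha.le).symm⟩
  rw [Real.sqrt_sq hb.le]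
  rw [intervalIntegral.integral_eq_sub_of_hasDerivAt
    (fun θ _ => hasDerivAt_arctan_primitive hb θ)]
  · simp
  · refine Continuous.intervalIntegrable (Continuous.inv₀ (by fun_prop) fun θ => ?_) _ _
    simpa using (sin_sq_mul_add_pos one_pos (pow_pos hb 2) θ).ne'

section Matrices

variable {m : ℕ}

/-- The numerical range of `A` lies in the sector spanned by `1` and `z`: its values on nonzero
vectors are `α + β z` with `α > 0` and `β ≥ 0`. -/
def IsSectorial (z : ℂ) (A : Matrix (Fin m) (Fin m) ℂ) : Prop :=
  ∀ v : Fin m → ℂ, v ≠ 0 → ∃ α β : ℝ, 0 < α ∧ 0 ≤ β ∧ star v ⬝ᵥ (A *ᵥ v) = α + β * z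

lemma sector_ne_zero {z : ℂ} (hz : z ∈ Complex.slitPlane) {α β : ℝ} (hα : 0 < α) (hβ : 0 ≤ β) :
    (α + β * z : ℂ) ≠ 0 := by
  intro h
  have hre := congrArg Complex.re h
  have him := congrArg Complex.im h
  simp at hre him
  rcases him with rfl | him
  · simp at hre; exact hα.ne' hre
  · rcases hz with hz | hz
    · have := mul_nonneg hβ hz.le
      linarith
    · exact hz him

lemma IsSectorial.isUnit_det {z : ℂ} {A : Matrix (Fin m) (Fin m) ℂ} (h : IsSectorial z A)
    (hz : z ∈ Complex.slitPlane) : IsUnit A.det := by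
  rw [isUnit_iff_ne_zero]
  intro h0
  obtain ⟨v, hv, hv0⟩ := Matrix.exists_mulVec_eq_zero_iff.2 h0
  obtain ⟨α, β, hα, hβ, he⟩ := h v hv
  rw [hv0, dotProduct_zero] at he
  exact sector_ne_zero hz hα hβ he.symm

/-- The matrices `sin² θ + cos² θ A`, which join `A` to the identity matrix. -/
def pencil (A : Matrix (Fin m) (Fin m) ℂ) (θ : ℝ) : Matrix (Fin m) (Fin m) ℂ :=
  ((Real.sin θ ^ 2 : ℝ) : ℂ) • (1 : Matrix (Fin m) (Fin m) ℂ) + ((Real.cos θ ^ 2 : ℝ) : ℂ) • A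

lemma IsSectorial.pencil {z : ℂ} {A : Matrix (Fin m) (Fin m) ℂ} (h : IsSectorial z A) (θ : ℝ) :
    IsSectorial z (pencil A θ) := by
  intro v hv
  obtain ⟨α, β, hα, hβ, he⟩ := h v hv
  have hN : 0 < star v ⬝ᵥ v := Matrix.dotProduct_star_self_pos_iff.2 hv
  obtain ⟨hN1, hN2⟩ := Complex.pos_iff.1 hN
  have hN3 : star v ⬝ᵥ v = ((star v ⬝ᵥ v).re : ℂ) := Complex.ext rfl (by simpa using hN2.symm)
  refine ⟨_, Real.cos θ ^ 2 * β, sin_sq_mul_add_pos hN1 hα θ, by positivity, ?_⟩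
  rw [Viscoelastic.pencil, Matrix.add_mulVec, Matrix.smul_mulVec, Matrix.smul_mulVec,
    Matrix.one_mulVec, dotProduct_add, dotProduct_smul, dotProduct_smul, he, hN3]
  push_cast
  simp only [smul_eq_mul, Complex.ofReal_re]
  ring

lemma differentiableOn_det {U : Set ℂ} {M : ℂ → Matrix (Fin m) (Fin m) ℂ}
    (h : ∀ i j, DifferentiableOn ℂ (fun z => M z i j) U) :
    DifferentiableOn ℂ (fun z => (M z).det) U := by
  simp only [Matrix.det_apply']
  exact DifferentiableOn.fun_sum fun σ _ =>
    (DifferentiableOn.fun_finsetProd fun i _ => h _ _).const_mul _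

lemma differentiableOn_inv {U : Set ℂ} {M : ℂ → Matrix (Fin m) (Fin m) ℂ}
    (h : ∀ i j, DifferentiableOn ℂ (fun z => M z i j) U) (hu : ∀ z ∈ U, IsUnit (M z).det)
    (i j : Fin m) : DifferentiableOn ℂ (fun z => (M z)⁻¹ i j) U := by
  simp only [Matrix.inv_def, Ring.inverse_eq_inv', Matrix.smul_apply, smul_eq_mul,
    Matrix.adjugate_apply]
  refine DifferentiableOn.mul ((differentiableOn_det h).inv fun z hz => (hu z hz).ne_zero)
    (differentiableOn_det fun k l => ?_)
  by_cases hk : k = j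
  · subst hk
    simp
  · simpa [Matrix.updateRow_ne hk] using h k l

lemma continuousOn_inv {X : Type*} [TopologicalSpace X] {S : Set X}
    {M : X → Matrix (Fin m) (Fin m) ℂ} (h : ContinuousOn M S) (hu : ∀ x ∈ S, IsUnit (M x).det) :
    ContinuousOn (fun x => (M x)⁻¹) S := by
  simp only [Matrix.inv_def, Ring.inverse_eq_inv']
  have hd : ContinuousOn (fun x => (M x).det) S :=
    (continuous_id.matrix_det).comp_continuousOn h
  have ha : ContinuousOn (fun x => (M x).adjugate) S :=
    (continuous_id.matrix_adjugate).comp_continuousOn h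
  exact (hd.inv₀ fun x hx => (hu x hx).ne_zero).smul ha

/-- The principal inverse square root `A^{-1/2}` of a sectorial matrix, as the integral
`(2 / π) ∫ (sin² θ + cos² θ A)⁻¹ dθ` over `[0, π / 2]`. -/
def invSqrt (A : Matrix (Fin m) (Fin m) ℂ) : Matrix (Fin m) (Fin m) ℂ :=
  Matrix.of fun i j => (2 / Real.pi : ℂ) * ∫ θ in (0 : ℝ)..(Real.pi / 2), (pencil A θ)⁻¹ i j

lemma continuous_pencil_inv {A : Matrix (Fin m) (Fin m) ℂ}
    (hA : ∀ θ, IsUnit (pencil A θ).det) : Continuous fun θ => (pencil A θ)⁻¹ := by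
  rw [← continuousOn_univ]
  refine continuousOn_inv ?_ fun θ _ => hA θ
  unfold pencil
  fun_prop

lemma dotProduct_invSqrt_mulVec {A : Matrix (Fin m) (Fin m) ℂ}
    (hA : ∀ θ, IsUnit (pencil A θ).det) (u v : Fin m → ℂ) :
    u ⬝ᵥ (invSqrt A *ᵥ v) = (2 / Real.pi : ℂ) *
      ∫ θ in (0 : ℝ)..(Real.pi / 2), u ⬝ᵥ ((pencil A θ)⁻¹ *ᵥ v) := by
  have hc : ∀ i j, Continuous fun θ => (pencil A θ)⁻¹ i j := fun i j =>
    (continuous_pencil_inv hA).matrix_elem i j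
  simp only [dotProduct, Matrix.mulVec, Finset.mul_sum]
  rw [intervalIntegral.integral_finsetSum fun i _ => Continuous.intervalIntegrable (by
    exact continuous_finsetSum _ fun j _ => ((hc i j).mul_const _).const_mul _) _ _,
    Finset.mul_sum]
  refine Finset.sum_congr rfl fun i _ => ?_
  rw [intervalIntegral.integral_finsetSum fun j _ => Continuous.intervalIntegrable (by
    exact ((hc i j).mul_const _).const_mul _) _ _, Finset.mul_sum]
  refine Finset.sum_congr rfl fun j _ => ?_
  rw [intervalIntegral.integral_const_mul, intervalIntegral.integral_mul_const, invSqrt,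
    Matrix.of_apply]
  ring

/-- On eigenvectors with a positive eigenvalue `a`, `invSqrt A` acts as `a^{-1/2}`. -/
lemma invSqrt_mulVec_of_eigen {A : Matrix (Fin m) (Fin m) ℂ}
    (hA : ∀ θ, IsUnit (pencil A θ).det) {a : ℝ} (ha : 0 < a) {u : Fin m → ℂ}
    (hu : A *ᵥ u = (a : ℂ) • u) : invSqrt A *ᵥ u = (((Real.sqrt a)⁻¹ : ℝ) : ℂ) • u := by
  have h1 : ∀ θ, (pencil A θ)⁻¹ *ᵥ u =
      (((Real.sin θ ^ 2 + Real.cos θ ^ 2 * a)⁻¹ : ℝ) : ℂ) • u := by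
    intro θ
    have hpos : 0 < Real.sin θ ^ 2 + Real.cos θ ^ 2 * a := by
      simpa using sin_sq_mul_add_pos one_pos ha θ
    have h2 : pencil A θ *ᵥ u = ((Real.sin θ ^ 2 + Real.cos θ ^ 2 * a : ℝ) : ℂ) • u := by
      rw [pencil, Matrix.add_mulVec, Matrix.smul_mulVec, Matrix.smul_mulVec, Matrix.one_mulVec,
        hu, smul_smul, ← add_smul]
      push_cast
      rfl
    have h3 := congrArg (fun w => (((Real.sin θ ^ 2 + Real.cos θ ^ 2 * a)⁻¹ : ℝ) : ℂ) •
      ((pencil A θ)⁻¹ *ᵥ w)) h2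
    simp only [Matrix.mulVec_mulVec, Matrix.nonsing_inv_mul _ (hA θ), Matrix.one_mulVec,
      Matrix.mulVec_smul, smul_smul, ← Complex.ofReal_mul, inv_mul_cancel₀ hpos.ne'] at h3
    simpa using h3.symm
  funext i
  have h2 := dotProduct_invSqrt_mulVec hA (Pi.single i 1) u
  simp only [single_dotProduct, one_mul, h1, Pi.smul_apply, smul_eq_mul,
    intervalIntegral.integral_mul_const] at h2
  rw [h2, intervalIntegral.integral_ofReal, integral_inv_sin_sq_add ha]
  have := Real.pi_ne_zero
  simp only [Pi.smul_apply, smul_eq_mul]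
  push_cast
  field_simp

/-- The values of the form `v† z A⁻¹ v` for a sectorial matrix `A`. -/
lemma IsSectorial.inv {z : ℂ} {A : Matrix (Fin m) (Fin m) ℂ} (h : IsSectorial z A)
    (hz : z ∈ Complex.slitPlane) {v : Fin m → ℂ} (hv : v ≠ 0) :
    ∃ α β : ℝ, 0 < α ∧ 0 ≤ β ∧ z * (star v ⬝ᵥ (A⁻¹ *ᵥ v)) = β + α * z := by
  have hA := h.isUnit_det hz
  -- with `w = A⁻¹ v` the value is `z` times the conjugate of `w† A w`
  have hw : A *ᵥ (A⁻¹ *ᵥ v) = v := by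
    rw [Matrix.mulVec_mulVec, Matrix.mul_nonsing_inv _ hA, Matrix.one_mulVec]
  set w := A⁻¹ *ᵥ v
  have hw0 : w ≠ 0 := by
    intro h0
    rw [h0, Matrix.mulVec_zero] at hw
    exact hv hw.symm
  obtain ⟨α, β, hα, hβ, he⟩ := h w hw0
  refine ⟨α, β * Complex.normSq z, hα, mul_nonneg hβ (Complex.normSq_nonneg z), ?_⟩
  have h1 : star v ⬝ᵥ w = star (star w ⬝ᵥ (A *ᵥ w)) := by
    rw [hw, Matrix.star_dotProduct]
  rw [h1, he]
  have := Complex.mul_conj z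
  simp only [star_add, star_mul', Complex.star_def, Complex.conj_ofReal]
  push_cast
  rw [← this]
  ring

lemma IsSectorial.dotProduct_invSqrt {z : ℂ} {A : Matrix (Fin m) (Fin m) ℂ} (h : IsSectorial z A)
    (hz : z ∈ Complex.slitPlane) (v : Fin m → ℂ) :
    IntervalIntegrable (fun θ => z * (star v ⬝ᵥ ((Viscoelastic.pencil A θ)⁻¹ *ᵥ v))) volume
      0 (Real.pi / 2) ∧
    z * (star v ⬝ᵥ (invSqrt A *ᵥ v)) = ((2 / Real.pi : ℝ) : ℂ) *
      ∫ θ in (0 : ℝ)..(Real.pi / 2), z * (star v ⬝ᵥ ((Viscoelastic.pencil A θ)⁻¹ *ᵥ v)) := by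
  have hA : ∀ θ, IsUnit (Viscoelastic.pencil A θ).det := fun θ => (h.pencil θ).isUnit_det hz
  constructor
  · refine Continuous.intervalIntegrable ?_ _ _
    have := continuous_pencil_inv hA
    exact continuous_const.mul (continuous_const.dotProduct (this.matrix_mulVec continuous_const))
  · rw [dotProduct_invSqrt_mulVec hA, intervalIntegral.integral_const_mul]
    push_cast
    ring

/-- The imaginary part of `z A^{-1/2}` is definite, of the sign of the imaginary part of `z`. -/
lemma IsSectorial.im_invSqrt_pos {z : ℂ} {A : Matrix (Fin m) (Fin m) ℂ} (h : IsSectorial z A)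
    (hz : z.im ≠ 0) {v : Fin m → ℂ} (hv : v ≠ 0) :
    0 < z.im * (z * (star v ⬝ᵥ (invSqrt A *ᵥ v))).im := by
  have hz' : z ∈ Complex.slitPlane := Or.inr hz
  obtain ⟨hi, he⟩ := h.dotProduct_invSqrt hz' v
  have hpi := Real.pi_pos
  rw [he, Complex.im_ofReal_mul,
    ← Complex.imCLM_apply (∫ θ in _.._, _), ← Complex.imCLM.intervalIntegral_comp_comm hi,
    mul_left_comm, ← intervalIntegral.integral_const_mul]
  refine mul_pos (by positivity) (intervalIntegral.intervalIntegral_pos_of_pos_on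
    (IntervalIntegrable.const_mul
      ⟨Complex.imCLM.integrable_comp hi.1, Complex.imCLM.integrable_comp hi.2⟩ _)
      (fun θ _ => ?_) (by positivity))
  obtain ⟨α, β, hα, -, he⟩ := (h.pencil θ).inv hz' hv
  rw [he]
  have : 0 < z.im * z.im := mul_self_pos.2 hz
  have := mul_pos hα this
  simp
  linarith

/-- `z A^{-1/2}` is accretive for `z` in the right half-plane. -/
lemma IsSectorial.re_invSqrt_nonneg {z : ℂ} {A : Matrix (Fin m) (Fin m) ℂ} (h : IsSectorial z A)
    (hz : z ∈ Complex.slitPlane) (hre : 0 ≤ z.re) (v : Fin m → ℂ) :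
    0 ≤ (z * (star v ⬝ᵥ (invSqrt A *ᵥ v))).re := by
  rcases eq_or_ne v 0 with rfl | hv
  · simp
  obtain ⟨hi, he⟩ := h.dotProduct_invSqrt hz v
  have hpi := Real.pi_pos
  rw [he, Complex.re_ofReal_mul, ← Complex.reCLM_apply,
    ← Complex.reCLM.intervalIntegral_comp_comm hi]
  refine mul_nonneg (by positivity) (intervalIntegral.integral_nonneg (by positivity)
    fun θ _ => ?_)
  obtain ⟨α, β, hα, hβ, he⟩ := (h.pencil θ).inv hz hv
  rw [he]
  have := mul_nonneg hα.le hre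
  simp
  linarith

/-- The inverse square root of a holomorphic sectorial matrix function is holomorphic. -/
lemma differentiableOn_invSqrt {Q : ℂ → Matrix (Fin m) (Fin m) ℂ}
    (hQ : ∀ i j, DifferentiableOn ℂ (fun z => Q z i j) Complex.slitPlane)
    (hs : ∀ z ∈ Complex.slitPlane, IsSectorial z (Q z)) (i j : Fin m) :
    DifferentiableOn ℂ (fun z => invSqrt (Q z) i j) Complex.slitPlane := by
  have hu : ∀ z ∈ Complex.slitPlane, ∀ θ, IsUnit (pencil (Q z) θ).det :=
    fun z hz θ => ((hs z hz).pencil θ).isUnit_det hz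
  have hQc : ContinuousOn Q Complex.slitPlane :=
    continuousOn_pi.2 fun i => continuousOn_pi.2 fun j => (hQ i j).continuousOn
  have hint := differentiableOn_setIntegral (μ := (volume : Measure ℝ))
    (isCompact_Icc (a := 0) (b := Real.pi / 2))
    Complex.isOpen_slitPlane (φ := fun z θ => (pencil (Q z) θ)⁻¹ i j) ?_ ?_
  · simp only [invSqrt, Matrix.of_apply,
      intervalIntegral.integral_of_le (by positivity : (0 : ℝ) ≤ Real.pi / 2),
      ← integral_Icc_eq_integral_Ioc]
    exact hint.const_mul _
  · have h1 : ContinuousOn (fun x : ℂ × ℝ => pencil (Q x.1) x.2)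
        (Complex.slitPlane ×ˢ Icc 0 (Real.pi / 2)) := by
      have h2 : ContinuousOn (fun x : ℂ × ℝ => Q x.1)
          (Complex.slitPlane ×ˢ Icc 0 (Real.pi / 2)) :=
        hQc.comp continuousOn_fst fun x hx => hx.1
      unfold pencil
      have hs : Continuous fun x : ℂ × ℝ => ((Real.sin x.2 ^ 2 : ℝ) : ℂ) :=
        Complex.continuous_ofReal.comp (by fun_prop)
      have hc : Continuous fun x : ℂ × ℝ => ((Real.cos x.2 ^ 2 : ℝ) : ℂ) :=
        Complex.continuous_ofReal.comp (by fun_prop)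
      exact (hs.continuousOn.smul continuousOn_const).add (hc.continuousOn.smul h2)
    have h3 := continuousOn_inv h1 fun x hx => hu x.1 hx.1 x.2
    exact continuousOn_pi.1 (continuousOn_pi.1 h3 i) j
  · intro θ _
    refine differentiableOn_inv (fun k l => ?_) (fun z hz => hu z hz θ) i j
    simp only [pencil, Matrix.add_apply, Matrix.smul_apply, smul_eq_mul]
    exact ((hQ k l).const_mul _).const_add _

end Matrices

/-! ### Real positive definite matrices -/

section RealMatrices

variable {m : ℕ}

/-- The complexification of a real vector. -/
def vecC (v : Fin m → ℝ) : Fin m → ℂ := fun i => (v i : ℂ)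

lemma toC_mulVec (A : Matrix (Fin m) (Fin m) ℝ) (v : Fin m → ℝ) :
    toC A *ᵥ vecC v = vecC (A *ᵥ v) := by
  funext i
  simp [toC, vecC, Matrix.mulVec, dotProduct]

lemma vecC_dotProduct (u v : Fin m → ℝ) : vecC u ⬝ᵥ vecC v = ((u ⬝ᵥ v : ℝ) : ℂ) := by
  simp [vecC, dotProduct]

lemma vecC_smul (a : ℝ) (v : Fin m → ℝ) : vecC (a • v) = (a : ℂ) • vecC v := by
  funext i
  simp [vecC]

lemma vecC_single (i : Fin m) : vecC (Pi.single i 1) = Pi.single i 1 := by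
  funext j
  by_cases h : j = i
  · subst h; simp [vecC]
  · simp [vecC, h]

lemma toC_mul (A B : Matrix (Fin m) (Fin m) ℝ) : toC (A * B) = toC A * toC B := by
  ext i j
  simp [toC, Matrix.mul_apply]

lemma toC_one : toC (1 : Matrix (Fin m) (Fin m) ℝ) = 1 := by
  ext i j
  by_cases h : i = j <;> simp [toC, Matrix.one_apply, h]

lemma toC_transpose (A : Matrix (Fin m) (Fin m) ℝ) : toC Aᵀ = (toC A)ᵀ := rfl

/-- The Hermitian form of a complex symmetric matrix is the sum of the values of its bilinear form
on the real and the imaginary part of the vector. -/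
lemma star_dotProduct_mulVec_of_symm {A : Matrix (Fin m) (Fin m) ℂ} (hA : Aᵀ = A)
    (v : Fin m → ℂ) : star v ⬝ᵥ (A *ᵥ v) =
      vecC (fun i => (v i).re) ⬝ᵥ (A *ᵥ vecC fun i => (v i).re) +
      vecC (fun i => (v i).im) ⬝ᵥ (A *ᵥ vecC fun i => (v i).im) := by
  set a := vecC fun i => (v i).re with ha
  set b := vecC fun i => (v i).im with hb
  have hv : v = a + Complex.I • b := by
    funext i
    simp only [ha, hb, vecC, Pi.add_apply, Pi.smul_apply, smul_eq_mul]
    rw [mul_comm, Complex.re_add_im]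
  have hsv : star v = a - Complex.I • b := by
    rw [hv]
    funext i
    simp [ha, hb, vecC, sub_eq_add_neg]
  have hab : a ⬝ᵥ (A *ᵥ b) = b ⬝ᵥ (A *ᵥ a) := by
    rw [Matrix.dotProduct_mulVec, ← Matrix.mulVec_transpose, hA, dotProduct_comm]
  rw [hsv, hv, Matrix.mulVec_add, Matrix.mulVec_smul, dotProduct_add, sub_dotProduct,
    sub_dotProduct, dotProduct_smul, dotProduct_smul, smul_dotProduct, smul_dotProduct, hab]
  simp only [smul_eq_mul]
  linear_combination (-(b ⬝ᵥ (A *ᵥ b))) * Complex.I_mul_I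

/-- The functional calculus of a Hermitian matrix acts on eigenvectors through the eigenvalue. -/
lemma cfc_mulVec_of_eigen {A : Matrix (Fin m) (Fin m) ℝ} (hA : A.IsHermitian) (g : ℝ → ℝ) {a : ℝ}
    {u : Fin m → ℝ} (hu : A *ᵥ u = a • u) : cfc g A *ᵥ u = g a • u := by
  set U : Matrix (Fin m) (Fin m) ℝ := hA.eigenvectorUnitary.1
  have hUU : Uᴴ * U = 1 := Unitary.coe_star_mul_self hA.eigenvectorUnitary
  have hUU' : U * Uᴴ = 1 := Unitary.coe_mul_star_self hA.eigenvectorUnitary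
  have hspec : A = U * Matrix.diagonal hA.eigenvalues * Uᴴ := by
    have := hA.spectral_theorem
    rwa [Unitary.conjStarAlgAut_apply] at this
  have hcfc : cfc g A = U * Matrix.diagonal (g ∘ hA.eigenvalues) * Uᴴ := by
    rw [hA.cfc_eq, Matrix.IsHermitian.cfc, Unitary.conjStarAlgAut_apply]
    rfl
  have hw : U *ᵥ (Uᴴ *ᵥ u) = u := by rw [Matrix.mulVec_mulVec, hUU', Matrix.one_mulVec]
  set w := Uᴴ *ᵥ u with hwd
  have h1 : Matrix.diagonal hA.eigenvalues *ᵥ w = a • w := by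
    have h2 := congrArg (fun x => Uᴴ *ᵥ x) hu
    simp only [Matrix.mulVec_smul, ← hwd] at h2
    rw [hspec, Matrix.mulVec_mulVec, ← Matrix.mul_assoc, ← Matrix.mul_assoc, hUU,
      Matrix.one_mul, ← Matrix.mulVec_mulVec, ← hwd] at h2
    exact h2
  have h2 : Matrix.diagonal (g ∘ hA.eigenvalues) *ᵥ w = g a • w := by
    funext i
    have h3 := congrFun h1 i
    simp only [Matrix.mulVec_diagonal, Pi.smul_apply, smul_eq_mul, Function.comp_apply] at h3 ⊢
    rcases eq_or_ne (w i) 0 with h0 | h0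
    · simp [h0]
    · rw [mul_right_cancel₀ h0 h3]
  rw [hcfc, Matrix.mul_assoc, ← Matrix.mulVec_mulVec, ← Matrix.mulVec_mulVec, ← hwd, h2,
    Matrix.mulVec_smul, hw]

lemma cfc_sqrt_mul_self {A : Matrix (Fin m) (Fin m) ℝ} (hA : A.PosDef) :
    cfc Real.sqrt A * cfc Real.sqrt A = A := by
  have hsa : IsSelfAdjoint A := hA.1
  rw [← cfc_mul Real.sqrt Real.sqrt A]
  conv_rhs => rw [← cfc_id ℝ A]
  refine cfc_congr fun x hx => ?_
  rw [hA.1.spectrum_real_eq_range_eigenvalues] at hx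
  obtain ⟨i, rfl⟩ := hx
  simp [Real.mul_self_sqrt (hA.eigenvalues_pos i).le]

lemma isUnit_det_cfc_sqrt {A : Matrix (Fin m) (Fin m) ℝ} (hA : A.PosDef) :
    IsUnit (cfc Real.sqrt A).det := by
  have h := congrArg Matrix.det (cfc_sqrt_mul_self hA)
  rw [Matrix.det_mul] at h
  exact isUnit_of_mul_isUnit_left (h ▸ hA.det_pos.ne'.isUnit)

lemma transpose_cfc_sqrt (A : Matrix (Fin m) (Fin m) ℝ) :
    (cfc Real.sqrt A)ᵀ = cfc Real.sqrt A := by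
  have h : IsSelfAdjoint (cfc Real.sqrt A) := cfc_predicate _ _
  simpa [IsSelfAdjoint, Matrix.star_eq_conjTranspose] using h

lemma inv_cfc_sqrt_mulVec_of_eigen {A : Matrix (Fin m) (Fin m) ℝ} (hA : A.PosDef) {a : ℝ}
    (ha : 0 < a) {u : Fin m → ℝ} (hu : A *ᵥ u = a • u) :
    (cfc Real.sqrt A)⁻¹ *ᵥ u = (Real.sqrt a)⁻¹ • u := by
  have h := congrArg (fun x => (Real.sqrt a)⁻¹ • ((cfc Real.sqrt A)⁻¹ *ᵥ x))
    (cfc_mulVec_of_eigen hA.1 Real.sqrt hu)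
  simp only [Matrix.mulVec_mulVec, Matrix.nonsing_inv_mul _ (isUnit_det_cfc_sqrt hA),
    Matrix.one_mulVec, Matrix.mulVec_smul, smul_smul,
    inv_mul_cancel₀ (Real.sqrt_pos.2 ha).ne', one_smul] at h
  exact h.symm

/-- The inverse of the square root given by the functional calculus of a real positive definite
matrix is given by the integral `invSqrt`: both act alike on a basis of eigenvectors. -/
lemma toC_inv_cfc_sqrt {A : Matrix (Fin m) (Fin m) ℝ} (hA : A.PosDef)
    (hu : ∀ θ, IsUnit (pencil (toC A) θ).det) :
    toC (cfc Real.sqrt A)⁻¹ = invSqrt (toC A) := by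
  set U : Matrix (Fin m) (Fin m) ℝ := hA.1.eigenvectorUnitary.1
  have hUU' : U * Uᴴ = 1 := Unitary.coe_mul_star_self hA.1.eigenvectorUnitary
  have key : toC (cfc Real.sqrt A)⁻¹ * toC U = invSqrt (toC A) * toC U := by
    ext i j
    have he : A *ᵥ (fun k => U k j) = hA.1.eigenvalues j • fun k => U k j := by
      have := hA.1.mulVec_eigenvectorBasis j
      exact this
    have h1 := inv_cfc_sqrt_mulVec_of_eigen hA (hA.eigenvalues_pos j) he
    have h2 : toC A *ᵥ vecC (fun k => U k j) =
        (hA.1.eigenvalues j : ℂ) • vecC fun k => U k j := by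
      rw [toC_mulVec, he, vecC_smul]
    have h3 := invSqrt_mulVec_of_eigen hu (hA.eigenvalues_pos j) h2
    have h4 : toC (cfc Real.sqrt A)⁻¹ *ᵥ vecC (fun k => U k j) =
        invSqrt (toC A) *ᵥ vecC (fun k => U k j) := by
      rw [toC_mulVec, h1, h3, vecC_smul]
    exact congrFun h4 i
  have h5 := congrArg (fun X => X * toC Uᴴ) key
  simpa only [Matrix.mul_assoc, ← toC_mul, hUU', toC_one, Matrix.mul_one] using h5

/-- A lower bound of `A` bounds the entries of `A^{-1/2}`. -/
lemma inv_cfc_sqrt_apply_sq_le {A : Matrix (Fin m) (Fin m) ℝ} (hA : A.PosDef) {c : ℝ} (hc : 0 < c)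
    (h : ∀ x, c * (x ⬝ᵥ x) ≤ x ⬝ᵥ (A *ᵥ x)) (i j : Fin m) :
    ((cfc Real.sqrt A)⁻¹ i j) ^ 2 ≤ c⁻¹ := by
  have hB := isUnit_det_cfc_sqrt hA
  have hBB := cfc_sqrt_mul_self hA
  have hBt := transpose_cfc_sqrt A
  set B := cfc Real.sqrt A
  -- the column `y = B⁻¹ eⱼ` satisfies `c |y|² ≤ y · A y = |B y|² = 1`
  set y := B⁻¹ *ᵥ Pi.single j 1 with hy
  have hBy : B *ᵥ y = Pi.single j 1 := by
    rw [hy, Matrix.mulVec_mulVec, Matrix.mul_nonsing_inv _ hB, Matrix.one_mulVec]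
  have h1 := h y
  have h2 : y ⬝ᵥ (A *ᵥ y) = 1 := by
    rw [← hBB, ← Matrix.mulVec_mulVec, hBy, Matrix.dotProduct_mulVec, ← Matrix.mulVec_transpose,
      hBt, hBy]
    simp
  have h3 : y i = B⁻¹ i j := by rw [hy, Matrix.mulVec_single_one]; rfl
  have h4 : y i ^ 2 ≤ y ⬝ᵥ y := by
    rw [sq]
    exact Finset.single_le_sum (f := fun k => y k * y k) (fun k _ => mul_self_nonneg _)
      (Finset.mem_univ i)
  rw [← h3]
  refine h4.trans ?_
  rw [h2] at h1
  rwa [← one_div, le_div_iff₀' hc]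

/-- A positive definite quadratic form is bounded below on the unit sphere. -/
lemma exists_pos_le_dotProduct_mulVec {A : Matrix (Fin m) (Fin m) ℝ}
    (hA : ∀ x, x ≠ 0 → 0 < x ⬝ᵥ (A *ᵥ x)) : ∃ c, 0 < c ∧ ∀ x, c * (x ⬝ᵥ x) ≤ x ⬝ᵥ (A *ᵥ x) := by
  have hS : IsCompact {x : Fin m → ℝ | x ⬝ᵥ x = 1} := by
    refine Metric.isCompact_of_isClosed_isBounded (isClosed_eq (by fun_prop) continuous_const) ?_
    refine (Metric.isBounded_closedBall (x := (0 : Fin m → ℝ)) (r := 1)).subset fun x hx => ?_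
    rw [mem_closedBall_zero_iff, pi_norm_le_iff_of_nonneg zero_le_one]
    intro i
    have h4 : x i * x i ≤ x ⬝ᵥ x :=
      Finset.single_le_sum (f := fun k => x k * x k) (fun k _ => mul_self_nonneg _)
        (Finset.mem_univ i)
    rw [show x ⬝ᵥ x = 1 from hx] at h4
    rw [Real.norm_eq_abs, ← sq_le_one_iff_abs_le_one]
    linarith [sq (x i)]
  have hscale : ∀ x : Fin m → ℝ, x ≠ 0 → 0 < x ⬝ᵥ x ∧
      ((Real.sqrt (x ⬝ᵥ x))⁻¹ • x) ⬝ᵥ ((Real.sqrt (x ⬝ᵥ x))⁻¹ • x) = 1 := by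
    intro x hx
    have h0 : 0 < x ⬝ᵥ x := by simpa using Matrix.dotProduct_star_self_pos_iff.2 hx
    refine ⟨h0, ?_⟩
    rw [smul_dotProduct, dotProduct_smul, smul_smul, ← mul_inv, Real.mul_self_sqrt h0.le,
      smul_eq_mul, inv_mul_cancel₀ h0.ne']
  rcases eq_empty_or_nonempty {x : Fin m → ℝ | x ⬝ᵥ x = 1} with he | hne
  · refine ⟨1, one_pos, fun x => ?_⟩
    rcases eq_or_ne x 0 with rfl | hx
    · simp
    · exact absurd (hscale x hx).2 (eq_empty_iff_forall_notMem.1 he _)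
  obtain ⟨x₀, hx₀, hmin⟩ := hS.exists_isMinOn hne
    (f := fun x => x ⬝ᵥ (A *ᵥ x)) (by fun_prop)
  refine ⟨x₀ ⬝ᵥ (A *ᵥ x₀), hA x₀ ?_, fun x => ?_⟩
  · rintro rfl
    simp at hx₀
  rcases eq_or_ne x 0 with rfl | hx
  · simp
  obtain ⟨h0, h1⟩ := hscale x hx
  have h2 : x₀ ⬝ᵥ (A *ᵥ x₀) ≤ _ := hmin h1
  simp only at h2
  rw [Matrix.mulVec_smul, smul_dotProduct, dotProduct_smul, smul_smul, ← mul_inv,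
    Real.mul_self_sqrt h0.le, smul_eq_mul, inv_mul_eq_div, le_div_iff₀ h0] at h2
  exact h2

end RealMatrices

/-! ### Continuation of the matrix of moduli -/

/-- The analytic continuation from `]0, ∞[` to the cut plane is unique. -/
lemma eqOn_slitPlane_of_eq_ofReal {F H : ℂ → ℂ} (hF : DifferentiableOn ℂ F Complex.slitPlane)
    (hH : DifferentiableOn ℂ H Complex.slitPlane) (h : ∀ p : ℝ, 0 < p → F p = H p) :
    EqOn F H Complex.slitPlane := by
  refine (hF.analyticOnNhd Complex.isOpen_slitPlane).eqOn_of_preconnected_of_frequently_eq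
    (hH.analyticOnNhd Complex.isOpen_slitPlane)
    (Complex.starConvex_one_slitPlane.isPathConnected
      Complex.one_mem_slitPlane).isConnected.isPreconnected
    Complex.one_mem_slitPlane ?_
  have hseq : Tendsto (fun n : ℕ => ((1 + 1 / ((n : ℝ) + 1) : ℝ) : ℂ)) atTop (𝓝[≠] 1) := by
    refine tendsto_nhdsWithin_iff.2 ⟨?_, .of_forall fun n => ?_⟩
    · have h1 := tendsto_one_div_add_atTop_nhds_zero_nat (𝕜 := ℝ)
      have h2 := (Complex.continuous_ofReal.tendsto (1 + 0)).comp (h1.const_add 1)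
      simpa [Function.comp_def] using h2
    · have : (0 : ℝ) < 1 / ((n : ℝ) + 1) := by positivity
      simp only [mem_compl_iff, mem_singleton_iff]
      rw [← Complex.ofReal_one, Complex.ofReal_inj]
      linarith
  exact hseq.frequently (Frequently.of_forall fun n => h _ (by positivity))

section Tensors

variable {d : ℕ}

lemma Tensor4.IsSymmetric.minor {H : Tensor4 d} (h : H.IsSymmetric) (i j k l : Fin d) :
    H i j k l = H i j l k := by
  rw [h.2, h.1, ← h.2]

/-- The symmetric part of the dyad `a ⊗ n`. -/
def symDyad (a n : Fin d → ℝ) : Matrix (Fin d) (Fin d) ℝ :=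
  Matrix.of fun i j => (a i * n j + a j * n i) / 2

lemma symDyad_isSymm (a n : Fin d → ℝ) : (symDyad a n).IsSymm := by
  ext i j
  simp [symDyad, add_comm]

lemma symDyad_ne_zero {a n : Fin d → ℝ} (hn : n ⬝ᵥ n = 1) (ha : a ≠ 0) : symDyad a n ≠ 0 := by
  intro h
  have h1 : ∀ i j, a i * n j + a j * n i = 0 := fun i j => by
    have := congrFun (congrFun h i) j
    simp only [symDyad, Matrix.of_apply, Matrix.zero_apply] at this
    linarith
  apply ha
  funext i
  -- contract with `n`, using that `a i * n i = 0`
  have h2 : ∀ i, a i * n i = 0 := fun i => by linarith [h1 i i]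
  have h3 : a i * (n ⬝ᵥ n) = ∑ j, -(a j * n j) * n i := by
    rw [dotProduct, Finset.mul_sum]
    refine Finset.sum_congr rfl fun j _ => ?_
    linear_combination n j * h1 i j
  rw [hn, mul_one] at h3
  simp [h3, h2]

lemma sum_symDyad_mul {X : Fin d → Fin d → ℝ} (hX : ∀ i j, X i j = X j i) (a n : Fin d → ℝ) :
    ∑ i, ∑ j, symDyad a n i j * X i j = ∑ i, ∑ j, a i * n j * X i j := by
  have h : ∑ i, ∑ j, a j * n i * X i j = ∑ i, ∑ j, a i * n j * X i j := by
    rw [Finset.sum_comm]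
    refine Finset.sum_congr rfl fun i _ => Finset.sum_congr rfl fun j _ => ?_
    rw [hX]
  have h2 : ∑ i, ∑ j, symDyad a n i j * X i j =
      (∑ i, ∑ j, a i * n j * X i j + ∑ i, ∑ j, a j * n i * X i j) / 2 := by
    simp only [← Finset.sum_add_distrib, Finset.sum_div, symDyad, Matrix.of_apply]
    refine Finset.sum_congr rfl fun i _ => Finset.sum_congr rfl fun j _ => ?_
    ring
  rw [h2, h]
  ring

/-- The bilinear form `⟨E, H C⟩` of a rank-4 tensor. -/
def Tensor4.bilin (H : Tensor4 d) (E C : Matrix (Fin d) (Fin d) ℝ) : ℝ :=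
  ∑ i, ∑ j, E i j * ∑ k, ∑ l, C k l * H i j k l

lemma Tensor4.quad_eq_bilin (H : Tensor4 d) (E : Matrix (Fin d) (Fin d) ℝ) :
    H.quad E = H.bilin E E := by
  simp only [Tensor4.quad, Tensor4.bilin, Finset.mul_sum]
  refine Finset.sum_congr rfl fun i _ => Finset.sum_congr rfl fun j _ =>
    Finset.sum_congr rfl fun k _ => Finset.sum_congr rfl fun l _ => ?_
  ring

lemma Tensor4.bilin_add_left (H : Tensor4 d) (E E' C : Matrix (Fin d) (Fin d) ℝ) :
    H.bilin (E + E') C = H.bilin E C + H.bilin E' C := by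
  simp only [Tensor4.bilin, Matrix.add_apply, add_mul, Finset.sum_add_distrib]

lemma Tensor4.bilin_add_right (H : Tensor4 d) (E C C' : Matrix (Fin d) (Fin d) ℝ) :
    H.bilin E (C + C') = H.bilin E C + H.bilin E C' := by
  simp only [Tensor4.bilin, Matrix.add_apply, add_mul, mul_add, Finset.sum_add_distrib]

lemma Tensor4.IsSymmetric.bilin_comm {H : Tensor4 d} (h : H.IsSymmetric)
    (E C : Matrix (Fin d) (Fin d) ℝ) : H.bilin E C = H.bilin C E := by
  have : H.bilin E C = ∑ x : Fin d × Fin d, ∑ y : Fin d × Fin d,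
      E x.1 x.2 * (C y.1 y.2 * H x.1 x.2 y.1 y.2) := by
    simp only [Tensor4.bilin, Finset.mul_sum, Fintype.sum_prod_type]
  rw [this, Finset.sum_comm]
  simp only [Tensor4.bilin, Finset.mul_sum, Fintype.sum_prod_type]
  refine Finset.sum_congr rfl fun i _ => Finset.sum_congr rfl fun j _ =>
    Finset.sum_congr rfl fun k _ => Finset.sum_congr rfl fun l _ => ?_
  rw [h.2 k l i j]
  ring

lemma Tensor4.IsSymmetric.bilin_symDyad {H : Tensor4 d} (h : H.IsSymmetric)
    (a b c e : Fin d → ℝ) : H.bilin (symDyad a b) (symDyad c e) =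
      ∑ i, ∑ j, a i * b j * ∑ k, ∑ l, c k * e l * H i j k l := by
  have h1 : ∀ i j, ∑ k, ∑ l, symDyad c e k l * H i j k l = ∑ k, ∑ l, c k * e l * H i j k l :=
    fun i j => sum_symDyad_mul (fun k l => h.minor i j k l) c e
  simp only [Tensor4.bilin, h1]
  exact sum_symDyad_mul (X := fun i j => ∑ k, ∑ l, c k * e l * H i j k l)
    (fun i j => Finset.sum_congr rfl fun k _ => Finset.sum_congr rfl fun l _ => by rw [h.1]) a b

/-- The components of a symmetric tensor, by polarization of its quadratic form. -/
lemma Tensor4.IsSymmetric.apply_eq {H : Tensor4 d} (h : H.IsSymmetric) (i j k l : Fin d) :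
    H i j k l =
      (H.quad (symDyad (Pi.single i 1) (Pi.single j 1) + symDyad (Pi.single k 1) (Pi.single l 1)) -
        H.quad (symDyad (Pi.single i 1) (Pi.single j 1)) -
        H.quad (symDyad (Pi.single k 1) (Pi.single l 1))) / 2 := by
  have h1 : H.bilin (symDyad (Pi.single i 1) (Pi.single j 1))
      (symDyad (Pi.single k 1) (Pi.single l 1)) = H i j k l := by
    rw [h.bilin_symDyad]
    simp [Pi.single_apply]
  simp only [Tensor4.quad_eq_bilin, Tensor4.bilin_add_left, Tensor4.bilin_add_right]
  rw [h.bilin_comm (symDyad (Pi.single k 1) (Pi.single l 1)), h1]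
  ring

/-- The quadratic form of `H_n` is that of `H` on symmetrized dyads. -/
lemma Tensor4.IsSymmetric.quad_symDyad {H : Tensor4 d} (h : H.IsSymmetric) (a n : Fin d → ℝ) :
    H.quad (symDyad a n) = a ⬝ᵥ (H.contract n *ᵥ a) := by
  rw [Tensor4.quad_eq_bilin, h.bilin_symDyad]
  simp only [dotProduct, Matrix.mulVec, Tensor4.contract, Matrix.of_apply, Finset.mul_sum,
    Finset.sum_mul]
  refine Finset.sum_congr rfl fun i _ => ?_
  rw [Finset.sum_comm]
  refine Finset.sum_congr rfl fun k _ => Finset.sum_congr rfl fun j _ =>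
    Finset.sum_congr rfl fun l _ => ?_
  ring

lemma Tensor4.IsSymmetric.transpose_contract {H : Tensor4 d} (h : H.IsSymmetric)
    (n : Fin d → ℝ) : (H.contract n)ᵀ = H.contract n := by
  ext i k
  simp only [Matrix.transpose_apply, Tensor4.contract, Matrix.of_apply]
  rw [Finset.sum_comm]
  refine Finset.sum_congr rfl fun j _ => Finset.sum_congr rfl fun l _ => ?_
  rw [h.2]
  ring

lemma Tensor4.continuous_quad (E : Matrix (Fin d) (Fin d) ℝ) :
    Continuous fun H : Tensor4 d => H.quad E := by
  unfold Tensor4.quad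
  fun_prop

namespace IsSolidModulus

variable {G : ℝ → Tensor4 d}

lemma integrableOn_quad (hG : IsSolidModulus G) {E : Matrix (Fin d) (Fin d) ℝ} (hE : E.IsSymm)
    {p : ℝ} (hp : 0 < p) :
    IntegrableOn (fun t => Real.exp (-p * t) * (G t).quad E) (Ioi 0) := by
  obtain ⟨G₀, hG₀⟩ := hG.limit_zero
  exact (hG.cm E hE).integrableOn_exp_mul (fun t ht => (hG.cm E hE).le_of_tendsto_zero
    (((Tensor4.continuous_quad E).tendsto G₀).comp hG₀) ht) hp

lemma integrableOn_apply (hG : IsSolidModulus G) {p : ℝ} (hp : 0 < p) (i j k l : Fin d) :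
    IntegrableOn (fun t => Real.exp (-p * t) * G t i j k l) (Ioi 0) := by
  have hs := fun i j : Fin d => symDyad_isSymm (Pi.single i (1 : ℝ)) (Pi.single j 1)
  refine IntegrableOn.congr_fun ((((hG.integrableOn_quad ((hs i j).add (hs k l)) hp).sub
    (hG.integrableOn_quad (hs i j) hp)).sub (hG.integrableOn_quad (hs k l) hp)).div_const
      2) (fun t ht => ?_) measurableSet_Ioi
  simp only [Pi.sub_apply]
  rw [(hG.symm t ht).apply_eq i j k l]
  ring

lemma isSymmetric_modulusQ (hG : IsSolidModulus G) (p : ℝ) : (modulusQ G p).IsSymmetric := by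
  refine ⟨fun i j k l => ?_, fun i j k l => ?_⟩
  · unfold modulusQ
    congr 1
    refine setIntegral_congr_fun measurableSet_Ioi fun t ht => ?_
    simp only [(hG.symm t ht).1 i j k l]
  · unfold modulusQ
    congr 1
    refine setIntegral_congr_fun measurableSet_Ioi fun t ht => ?_
    simp only [(hG.symm t ht).2 i j k l]

lemma quad_modulusQ (hG : IsSolidModulus G) {p : ℝ} (hp : 0 < p)
    (E : Matrix (Fin d) (Fin d) ℝ) :
    (modulusQ G p).quad E = p * ∫ t in Ioi (0 : ℝ), Real.exp (-p * t) * (G t).quad E := by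
  have h : ∀ t, Real.exp (-p * t) * (G t).quad E =
      ∑ i, ∑ j, ∑ k, ∑ l, E i j * (Real.exp (-p * t) * G t i j k l) * E k l := by
    intro t
    simp only [Tensor4.quad, Finset.mul_sum]
    refine Finset.sum_congr rfl fun i _ => Finset.sum_congr rfl fun j _ =>
      Finset.sum_congr rfl fun k _ => Finset.sum_congr rfl fun l _ => ?_
    ring
  have hi : ∀ i j k l, IntegrableOn
      (fun t => E i j * (Real.exp (-p * t) * G t i j k l) * E k l) (Ioi 0) :=
    fun i j k l => ((hG.integrableOn_apply hp i j k l).const_mul _).mul_const _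
  simp only [h]
  rw [integral_finsetSum _ fun i _ => integrable_finsetSum _ fun j _ =>
    integrable_finsetSum _ fun k _ => integrable_finsetSum _ fun l _ => hi i j k l,
    Tensor4.quad, Finset.mul_sum]
  refine Finset.sum_congr rfl fun i _ => ?_
  rw [integral_finsetSum _ fun j _ => integrable_finsetSum _ fun k _ =>
    integrable_finsetSum _ fun l _ => hi i j k l, Finset.mul_sum]
  refine Finset.sum_congr rfl fun j _ => ?_
  rw [integral_finsetSum _ fun k _ => integrable_finsetSum _ fun l _ => hi i j k l,
    Finset.mul_sum]
  refine Finset.sum_congr rfl fun k _ => ?_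
  rw [integral_finsetSum _ fun l _ => hi i j k l, Finset.mul_sum]
  refine Finset.sum_congr rfl fun l _ => ?_
  rw [integral_mul_const, integral_const_mul, modulusQ]
  ring

lemma transpose_matrixQ (hG : IsSolidModulus G) (n : Fin d → ℝ) (p : ℝ) :
    (matrixQ G n p)ᵀ = matrixQ G n p :=
  (hG.isSymmetric_modulusQ p).transpose_contract n

lemma isSymmetric_of_tendsto (hG : IsSolidModulus G) {G₁ : Tensor4 d}
    (h : Tendsto G atTop (𝓝 G₁)) : G₁.IsSymmetric := by
  have hc : ∀ i j k l, Tendsto (fun t => G t i j k l) atTop (𝓝 (G₁ i j k l)) := fun i j k l =>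
    tendsto_pi_nhds.1 (tendsto_pi_nhds.1 (tendsto_pi_nhds.1 (tendsto_pi_nhds.1 h i) j) k) l
  refine ⟨fun i j k l => tendsto_nhds_unique_of_eventuallyEq (hc i j k l) (hc j i k l) ?_,
    fun i j k l => tendsto_nhds_unique_of_eventuallyEq (hc i j k l) (hc k l i j) ?_⟩
  · filter_upwards [eventually_gt_atTop 0] with t ht using (hG.symm t ht).1 i j k l
  · filter_upwards [eventually_gt_atTop 0] with t ht using (hG.symm t ht).2 i j k l

/-- For each real vector `a` the function `a · Q_n(p) a` continues to the cut plane, with values in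
a sector. -/
lemma exists_continuation_quad (hG : IsSolidModulus G) {n : Fin d → ℝ} (hn : n ⬝ᵥ n = 1)
    (a : Fin d → ℝ) : ∃ F : ℂ → ℂ,
      IsContinuation (fun p => a ⬝ᵥ (matrixQ G n p *ᵥ a)) F ∧
      ∀ z ∈ Complex.slitPlane, ∃ α β : ℝ, (a ≠ 0 → 0 < α) ∧ 0 ≤ α ∧ 0 ≤ β ∧
        F z = α + β * z := by
  obtain ⟨G₀, hG₀⟩ := hG.limit_zero
  obtain ⟨G₁, hG₁, hpos⟩ := hG.limit_infty
  have hE := symDyad_isSymm a n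
  have hc := (Tensor4.continuous_quad (symDyad a n)).tendsto
  obtain ⟨F, hF, hs⟩ := (hG.cm _ hE).exists_continuation ((hc G₀).comp hG₀) ((hc G₁).comp hG₁)
  have h1 : a ≠ 0 → 0 < G₁.quad (symDyad a n) := fun ha => hpos _ hE (symDyad_ne_zero hn ha)
  have h0 : 0 ≤ G₁.quad (symDyad a n) := by
    rcases eq_or_ne a 0 with rfl | ha
    · rw [(hG.isSymmetric_of_tendsto hG₁).quad_symDyad]; simp
    · exact (h1 ha).le
  refine ⟨F, ⟨hF.1, fun p hp => ?_⟩, fun z hz => ?_⟩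
  · change _ = ((a ⬝ᵥ ((modulusQ G p).contract n *ᵥ a) : ℝ) : ℂ)
    rw [hF.2 p hp, ← (hG.isSymmetric_modulusQ p).quad_symDyad, hG.quad_modulusQ hp]
  · obtain ⟨α, β, hα, hβ, he⟩ := hs z hz
    exact ⟨α, β, fun ha => (h1 ha).trans_le hα, h0.trans hα, hβ, he⟩

/-- The matrices `Q_n(p)` have a common positive lower bound: the equilibrium response. -/
lemma exists_lower_bound (hG : IsSolidModulus G) {n : Fin d → ℝ} (hn : n ⬝ᵥ n = 1) :
    ∃ c, 0 < c ∧ ∀ p, 0 < p → ∀ x, c * (x ⬝ᵥ x) ≤ x ⬝ᵥ (matrixQ G n p *ᵥ x) := by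
  obtain ⟨G₀, hG₀⟩ := hG.limit_zero
  obtain ⟨G₁, hG₁, hpos⟩ := hG.limit_infty
  have hsymm := hG.isSymmetric_of_tendsto hG₁
  obtain ⟨c, hc, h⟩ := exists_pos_le_dotProduct_mulVec (A := G₁.contract n) fun x hx => by
    rw [← hsymm.quad_symDyad]
    exact hpos _ (symDyad_isSymm x n) (symDyad_ne_zero hn hx)
  refine ⟨c, hc, fun p hp x => (h x).trans ?_⟩
  have hE := symDyad_isSymm x n
  have hl := ((Tensor4.continuous_quad (symDyad x n)).tendsto G₁).comp hG₁
  rw [matrixQ, ← (hG.isSymmetric_modulusQ p).quad_symDyad, hG.quad_modulusQ hp,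
    ← hsymm.quad_symDyad]
  have h1 : ∫ t in Ioi (0 : ℝ), Real.exp (-p * t) * G₁.quad (symDyad x n) ≤
      ∫ t in Ioi (0 : ℝ), Real.exp (-p * t) * (G t).quad (symDyad x n) :=
    setIntegral_mono_on ((integrableOn_exp_mul_Ioi (neg_lt_zero.2 hp) 0).mul_const _)
      (hG.integrableOn_quad hE hp) measurableSet_Ioi fun t ht =>
        mul_le_mul_of_nonneg_left ((hG.cm _ hE).le_of_tendsto_atTop hl ht) (Real.exp_nonneg _)
  rw [integral_mul_const, integral_exp_mul_Ioi (neg_lt_zero.2 hp)] at h1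
  have h2 := mul_le_mul_of_nonneg_left h1 hp.le
  refine le_trans (le_of_eq ?_) h2
  rw [mul_zero, Real.exp_zero]
  field_simp

lemma posDef_matrixQ (hG : IsSolidModulus G) {n : Fin d → ℝ} (hn : n ⬝ᵥ n = 1) {p : ℝ}
    (hp : 0 < p) : (matrixQ G n p).PosDef := by
  obtain ⟨c, hc, h⟩ := hG.exists_lower_bound hn
  refine Matrix.PosDef.of_dotProduct_mulVec_pos ?_ fun x hx => ?_
  · rw [Matrix.IsHermitian, Matrix.conjTranspose_eq_transpose_of_trivial, hG.transpose_matrixQ]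
  · rw [star_trivial]
    have : 0 < x ⬝ᵥ x := by simpa using Matrix.dotProduct_star_self_pos_iff.2 hx
    exact (mul_pos hc this).trans_le (h p hp x)

/-- `Q_n` continues to the cut plane, with sectorial symmetric values. -/
theorem exists_continuation_matrixQ (hG : IsSolidModulus G) {n : Fin d → ℝ} (hn : n ⬝ᵥ n = 1) :
    ∃ Qc : ℂ → Matrix (Fin d) (Fin d) ℂ, IsMatrixContinuation (matrixQ G n) Qc ∧
      ∀ z ∈ Complex.slitPlane, IsSectorial z (Qc z) := by
  choose F hF hs using hG.exists_continuation_quad hn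
  let e : Fin d → Fin d → ℝ := fun i => Pi.single i 1
  let Qc : ℂ → Matrix (Fin d) (Fin d) ℂ := fun z =>
    Matrix.of fun i k => (F (e i + e k) z - F (e i) z - F (e k) z) / 2
  have hQc : IsMatrixContinuation (matrixQ G n) Qc := by
    intro i k
    refine ⟨(((hF _).1.sub (hF _).1).sub (hF _).1).div_const 2, fun p hp => ?_⟩
    simp only [Qc, Matrix.of_apply]
    rw [(hF _).2 p hp, (hF _).2 p hp, (hF _).2 p hp]
    have h1 : matrixQ G n p k i = matrixQ G n p i k := by
      conv_lhs => rw [← hG.transpose_matrixQ n p, Matrix.transpose_apply]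
    simp only [Matrix.mulVec_add, dotProduct_add, add_dotProduct, e, Matrix.mulVec_single_one,
      single_one_dotProduct, Matrix.col_apply, h1]
    push_cast
    ring
  have hsymm : ∀ z, (Qc z)ᵀ = Qc z := by
    intro z
    ext i k
    simp only [Qc, Matrix.transpose_apply, Matrix.of_apply, add_comm (e k) (e i)]
    ring
  have hreal : ∀ (a : Fin d → ℝ) (z : ℂ), z ∈ Complex.slitPlane →
      vecC a ⬝ᵥ (Qc z *ᵥ vecC a) = F a z := by
    intro a
    refine eqOn_slitPlane_of_eq_ofReal (H := F a) ?_ (hF a).1 fun p hp => ?_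
    · simp only [dotProduct, Matrix.mulVec]
      exact DifferentiableOn.fun_sum fun i _ => (DifferentiableOn.fun_sum fun j _ =>
        (hQc i j).1.mul_const _).const_mul _
    · have : Qc p = toC (matrixQ G n p) := by
        ext i j
        exact (hQc i j).2 p hp
      rw [this, toC_mulVec, vecC_dotProduct, (hF a).2 p hp]
  refine ⟨Qc, hQc, fun z hz v hv => ?_⟩
  rw [star_dotProduct_mulVec_of_symm (hsymm z), hreal _ z hz, hreal _ z hz]
  obtain ⟨α₁, β₁, h1, h1', hβ₁, he₁⟩ := hs (fun i => (v i).re) z hz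
  obtain ⟨α₂, β₂, h2, h2', hβ₂, he₂⟩ := hs (fun i => (v i).im) z hz
  refine ⟨α₁ + α₂, β₁ + β₂, ?_, by positivity, ?_⟩
  · by_cases hr : (fun i => (v i).re) = 0
    · have : (fun i => (v i).im) ≠ 0 := fun hi =>
        hv (funext fun i => Complex.ext (congrFun hr i) (congrFun hi i))
      linarith [h2 this]
    · linarith [h1 hr]
  · rw [he₁, he₂]
    push_cast
    ring

end IsSolidModulus

end Tensors

/-! ### Continuation of the wave-number matrix -/

section HermitianParts

variable {m : ℕ}

lemma star_dotProduct_conjTranspose_mulVec (A : Matrix (Fin m) (Fin m) ℂ) (v : Fin m → ℂ) :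
    star v ⬝ᵥ (Aᴴ *ᵥ v) = star (star v ⬝ᵥ (A *ᵥ v)) := by
  rw [← Matrix.star_dotProduct, Matrix.star_mulVec, Matrix.dotProduct_mulVec]

lemma posSemidef_smul_imPart {A : Matrix (Fin m) (Fin m) ℂ} {c : ℝ}
    (h : ∀ v, 0 ≤ c * (star v ⬝ᵥ (A *ᵥ v)).im) : ((c : ℂ) • imPart A).PosSemidef := by
  refine Matrix.PosSemidef.of_dotProduct_mulVec_nonneg ?_ fun v => ?_
  · ext i j
    simp only [imPart, Matrix.conjTranspose_apply, Matrix.smul_apply, Matrix.sub_apply,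
      smul_eq_mul, Complex.star_def, map_mul, map_sub, Complex.conj_ofReal, Complex.conj_conj,
      map_div₀, map_one, Complex.conj_I, map_ofNat]
    field_simp
    ring
  · rw [imPart, Matrix.smul_mulVec, Matrix.smul_mulVec, Matrix.sub_mulVec, dotProduct_smul,
      dotProduct_smul, dotProduct_sub, star_dotProduct_conjTranspose_mulVec]
    have h1 : (star v ⬝ᵥ (A *ᵥ v)) - star (star v ⬝ᵥ (A *ᵥ v)) =
        2 * Complex.I * ((star v ⬝ᵥ (A *ᵥ v)).im : ℂ) := by
      rw [Complex.star_def, Complex.sub_conj]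
      push_cast
      ring
    rw [h1]
    have h2 : (c : ℂ) • ((1 / (2 * Complex.I) : ℂ) • (2 * Complex.I *
        ((star v ⬝ᵥ (A *ᵥ v)).im : ℂ))) = ((c * (star v ⬝ᵥ (A *ᵥ v)).im : ℝ) : ℂ) := by
      have := Complex.I_ne_zero
      simp only [smul_eq_mul]
      push_cast
      field_simp
    rw [h2]
    exact Complex.zero_le_real.2 (h v)

lemma posSemidef_rePart {A : Matrix (Fin m) (Fin m) ℂ}
    (h : ∀ v, 0 ≤ (star v ⬝ᵥ (A *ᵥ v)).re) : (rePart A).PosSemidef := by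
  refine Matrix.PosSemidef.of_dotProduct_mulVec_nonneg ?_ fun v => ?_
  · ext i j
    simp only [rePart, Matrix.conjTranspose_apply, Matrix.smul_apply, Matrix.add_apply,
      smul_eq_mul, Complex.star_def, map_mul, map_add, Complex.conj_conj,
      map_div₀, map_one, map_ofNat]
    ring
  · rw [rePart, Matrix.smul_mulVec, Matrix.add_mulVec, dotProduct_smul,
      dotProduct_add, star_dotProduct_conjTranspose_mulVec, Complex.star_def, Complex.add_conj]
    have h2 : (1 / 2 : ℂ) • (((2 * (star v ⬝ᵥ (A *ᵥ v)).re : ℝ)) : ℂ) =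
        (((star v ⬝ᵥ (A *ᵥ v)).re : ℝ) : ℂ) := by
      simp only [smul_eq_mul]
      push_cast
      ring
    rw [h2]
    exact Complex.zero_le_real.2 (h v)

lemma toC_transpose_eq_conjTranspose (R : Matrix (Fin m) (Fin m) ℝ) : toC Rᵀ = (toC R)ᴴ := by
  ext i j
  simp [toC]

lemma imPart_conj (R : Matrix (Fin m) (Fin m) ℝ) (A : Matrix (Fin m) (Fin m) ℂ) :
    imPart (toC R * A * toC Rᵀ) = toC R * imPart A * (toC R)ᴴ := by
  simp only [imPart, toC_transpose_eq_conjTranspose, Matrix.conjTranspose_mul,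
    Matrix.conjTranspose_conjTranspose, Matrix.mul_smul, Matrix.smul_mul, Matrix.mul_sub,
    Matrix.sub_mul, Matrix.mul_assoc]

lemma rePart_conj (R : Matrix (Fin m) (Fin m) ℝ) (A : Matrix (Fin m) (Fin m) ℂ) :
    rePart (toC R * A * toC Rᵀ) = toC R * rePart A * (toC R)ᴴ := by
  simp only [rePart, toC_transpose_eq_conjTranspose, Matrix.conjTranspose_mul,
    Matrix.conjTranspose_conjTranspose, Matrix.mul_smul, Matrix.smul_mul, Matrix.mul_add,
    Matrix.add_mul, Matrix.mul_assoc]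

end HermitianParts

section WaveNumber

variable {d : ℕ} {ρ : ℝ} {G : ℝ → Tensor4 d} {n : Fin d → ℝ}

lemma transpose_matrixK (ρ : ℝ) (G : ℝ → Tensor4 d) (n : Fin d → ℝ) (p : ℝ) :
    (matrixK ρ G n p)ᵀ = matrixK ρ G n p := by
  rw [matrixK, Matrix.transpose_smul, Matrix.transpose_nonsing_inv, transpose_cfc_sqrt]

/-- `K_n(p)` vanishes as `p → 0`, since `Q_n(p)` is bounded below. -/
lemma IsSolidModulus.tendsto_matrixK (hG : IsSolidModulus G) (hn : n ⬝ᵥ n = 1) (ρ : ℝ) :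
    Tendsto (matrixK ρ G n) (𝓝[>] 0) (𝓝 0) := by
  obtain ⟨c, hc, h⟩ := hG.exists_lower_bound hn
  refine tendsto_pi_nhds.2 fun i => tendsto_pi_nhds.2 fun j => ?_
  have hlim : Tendsto (fun p : ℝ => Real.sqrt ρ * p * Real.sqrt c⁻¹) (𝓝[>] 0) (𝓝 0) := by
    have : Tendsto (fun p : ℝ => Real.sqrt ρ * p * Real.sqrt c⁻¹) (𝓝 0)
        (𝓝 (Real.sqrt ρ * 0 * Real.sqrt c⁻¹)) := Continuous.tendsto (by fun_prop) 0
    simpa using this.mono_left nhdsWithin_le_nhds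
  refine squeeze_zero_norm' ?_ hlim
  filter_upwards [self_mem_nhdsWithin] with p hp
  have hp : 0 < p := hp
  have h1 := inv_cfc_sqrt_apply_sq_le (hG.posDef_matrixQ hn hp) hc (h p hp) i j
  simp only [matrixK, Matrix.smul_apply, smul_eq_mul, norm_mul, Real.norm_eq_abs,
    abs_of_nonneg (Real.sqrt_nonneg ρ), abs_of_pos hp]
  exact mul_le_mul_of_nonneg_left (Real.abs_le_sqrt h1) (by positivity)

/-- `K_n` continues to the cut plane; its Hermitian imaginary part has the sign of the imaginary
part of the argument, and its Hermitian real part is nonnegative in the right half-plane. -/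
theorem IsSolidModulus.exists_continuation_matrixK (hG : IsSolidModulus G) (hn : n ⬝ᵥ n = 1)
    (hρ : 0 < ρ) : ∃ Kc : ℂ → Matrix (Fin d) (Fin d) ℂ,
      IsMatrixContinuation (matrixK ρ G n) Kc ∧
      (∀ z : ℂ, z.im ≠ 0 → ∀ v, v ≠ 0 → 0 < z.im * (star v ⬝ᵥ (Kc z *ᵥ v)).im) ∧
      ∀ z ∈ Complex.slitPlane, 0 ≤ z.re → ∀ v, 0 ≤ (star v ⬝ᵥ (Kc z *ᵥ v)).re := by
  obtain ⟨Qc, hQc, hs⟩ := hG.exists_continuation_matrixQ hn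
  have hr : 0 < Real.sqrt ρ := Real.sqrt_pos.2 hρ
  have hmul : ∀ z v, star v ⬝ᵥ ((((Real.sqrt ρ : ℂ) * z) • invSqrt (Qc z)) *ᵥ v) =
      (Real.sqrt ρ : ℂ) * (z * (star v ⬝ᵥ (invSqrt (Qc z) *ᵥ v))) := by
    intro z v
    rw [Matrix.smul_mulVec, dotProduct_smul, smul_eq_mul, mul_assoc]
  refine ⟨fun z => ((Real.sqrt ρ : ℂ) * z) • invSqrt (Qc z), fun i j => ⟨?_, fun p hp => ?_⟩,
    fun z hz v hv => ?_, fun z hz hre v => ?_⟩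
  · simp only [Matrix.smul_apply, smul_eq_mul]
    exact (differentiableOn_id.const_mul _).mul
      (differentiableOn_invSqrt (fun i j => (hQc i j).1) hs i j)
  · have hp' := ofReal_mem_slitPlane hp
    have hQp : Qc p = toC (matrixQ G n p) := by
      ext i j
      exact (hQc i j).2 p hp
    have h1 := hs p hp'
    rw [hQp] at h1
    have h2 := toC_inv_cfc_sqrt (hG.posDef_matrixQ hn hp) fun θ => (h1.pencil θ).isUnit_det hp'
    simp only [hQp, ← h2, matrixK, Matrix.smul_apply, smul_eq_mul]
    simp only [toC, Matrix.map_apply]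
    push_cast
    rfl
  · have := (hs z (Or.inr hz)).im_invSqrt_pos hz hv
    rw [hmul, Complex.im_ofReal_mul, mul_left_comm]
    positivity
  · have := (hs z hz).re_invSqrt_nonneg hz hre v
    rw [hmul, Complex.re_ofReal_mul]
    positivity

lemma IsMatrixContinuation.apply_ofReal {A : ℝ → Matrix (Fin d) (Fin d) ℝ}
    {F : ℂ → Matrix (Fin d) (Fin d) ℂ} (h : IsMatrixContinuation A F) {p : ℝ} (hp : 0 < p) :
    F p = toC (A p) := by
  ext i j
  exact (h i j).2 p hp

lemma IsMatrixContinuation.transpose {A : ℝ → Matrix (Fin d) (Fin d) ℝ}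
    {F : ℂ → Matrix (Fin d) (Fin d) ℂ} (h : IsMatrixContinuation A F)
    (hA : ∀ p, 0 < p → (A p)ᵀ = A p) {z : ℂ} (hz : z ∈ Complex.slitPlane) : (F z)ᵀ = F z := by
  ext i j
  refine eqOn_slitPlane_of_eq_ofReal (h j i).1 (h i j).1 (fun p hp => ?_) hz
  have h1 := congrFun (congrFun (hA p hp) i) j
  rw [Matrix.transpose_apply] at h1
  simp only [h.apply_ofReal hp, toC, Matrix.map_apply, h1]

lemma IsMatrixContinuation.differentiableOn_mulVec {A : ℝ → Matrix (Fin d) (Fin d) ℝ}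
    {F : ℂ → Matrix (Fin d) (Fin d) ℂ} (h : IsMatrixContinuation A F) (v : Fin d → ℂ) (i : Fin d) :
    DifferentiableOn ℂ (fun z => (F z *ᵥ v) i) Complex.slitPlane := by
  simp only [dotProduct, Matrix.mulVec]
  exact DifferentiableOn.fun_sum fun j _ => (h i j).1.mul_const _

lemma IsMatrixContinuation.quad {A : ℝ → Matrix (Fin d) (Fin d) ℝ}
    {F : ℂ → Matrix (Fin d) (Fin d) ℂ} (h : IsMatrixContinuation A F) (f : Fin d → ℝ) :
    IsContinuation (fun p => f ⬝ᵥ (A p *ᵥ f)) fun z => vecC f ⬝ᵥ (F z *ᵥ vecC f) := by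
  constructor
  · simp only [dotProduct]
    exact DifferentiableOn.fun_sum fun i _ => (h.differentiableOn_mulVec _ i).const_mul _
  · intro p hp
    simp only [h.apply_ofReal hp, toC_mulVec, vecC_dotProduct]

lemma IsMatrixContinuation.conj {A : ℝ → Matrix (Fin d) (Fin d) ℝ}
    {F : ℂ → Matrix (Fin d) (Fin d) ℂ} (h : IsMatrixContinuation A F)
    (R : Matrix (Fin d) (Fin d) ℝ) :
    IsMatrixContinuation (fun p => R * A p * Rᵀ) fun z => toC R * F z * toC Rᵀ := by
  intro i j
  constructor
  · simp only [Matrix.mul_apply]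
    exact DifferentiableOn.fun_sum fun k _ => (DifferentiableOn.fun_sum fun l _ =>
      (h l k).1.const_mul _).mul_const _
  · intro p hp
    simp only [h.apply_ofReal hp, ← toC_mul]
    rfl

lemma IsContinuation.congr {f g : ℝ → ℝ} {F : ℂ → ℂ} (h : IsContinuation f F)
    (hfg : ∀ p, 0 < p → f p = g p) : IsContinuation g F :=
  ⟨h.1, fun p hp => by rw [h.2 p hp, hfg p hp]⟩

lemma star_vecC (f : Fin d → ℝ) : star (vecC f) = vecC f := by
  funext i
  simp [vecC]

lemma eigenvalue_eq {A : Matrix (Fin d) (Fin d) ℝ} {f : Fin d → ℝ} {k : ℝ} (hf : f ⬝ᵥ f = 1)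
    (h : A *ᵥ f = k • f) : k = f ⬝ᵥ (A *ᵥ f) := by
  rw [h, dotProduct_smul, hf, smul_eq_mul, mul_one]

/-- The eigenvalue of `K_n(p)` that belongs to a constant eigenvector is a complete Bernstein
function. -/
theorem IsSolidModulus.isCBF_eigenvalue (hG : IsSolidModulus G) (hn : n ⬝ᵥ n = 1) (hρ : 0 < ρ)
    {f : Fin d → ℝ} (hf : f ⬝ᵥ f = 1) {κ : ℝ → ℝ}
    (hκ : ∀ p, 0 < p → matrixK ρ G n p *ᵥ f = κ p • f) : IsCBF κ := by
  obtain ⟨Kc, hKc, him, -⟩ := hG.exists_continuation_matrixK hn hρ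
  have hκ' : ∀ p, 0 < p → f ⬝ᵥ (matrixK ρ G n p *ᵥ f) = κ p :=
    fun p hp => (eigenvalue_eq hf (hκ p hp)).symm
  have hf0 : vecC f ≠ 0 := by
    intro h
    have : f = 0 := funext fun i => Complex.ofReal_eq_zero.1 (congrFun h i)
    simp [this] at hf
  refine ⟨⟨_, (hKc.quad f).congr hκ', fun z hz => ?_⟩, 0, le_rfl, ?_⟩
  · by_cases h0 : z.im = 0
    · simp [h0]
    · have := him z h0 _ hf0
      rw [star_vecC] at this
      exact this.le
  · have h1 : Tendsto (fun p => f ⬝ᵥ (matrixK ρ G n p *ᵥ f)) (𝓝[>] 0) (𝓝 0) := by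
      have hc : Continuous fun A : Matrix (Fin d) (Fin d) ℝ => f ⬝ᵥ (A *ᵥ f) := by fun_prop
      simpa [Function.comp_def] using (hc.tendsto 0).comp (hG.tendsto_matrixK hn ρ)
    refine h1.congr' ?_
    filter_upwards [self_mem_nhdsWithin] with p hp using hκ' p hp

end WaveNumber

section BlockDiagonal

/-- The upper left `2 × 2` block of a `3 × 3` matrix. -/
def topBlock {R : Type} (M : Matrix (Fin 3) (Fin 3) R) : Matrix (Fin 2) (Fin 2) R :=
  M.submatrix ![0, 1] ![0, 1]

lemma eq_blockDiag_topBlock {R : Type} [CommRing R] {M : Matrix (Fin 3) (Fin 3) R} (hM : Mᵀ = M)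
    {k : R} (h : M *ᵥ Pi.single 2 1 = k • Pi.single 2 1) : M = blockDiag (topBlock M) k := by
  have h1 : ∀ i, M i 2 = k * (Pi.single 2 1 : Fin 3 → R) i := fun i => by
    have := congrFun h i
    rwa [Matrix.mulVec_single_one] at this
  have h2 : ∀ i, M 2 i = k * (Pi.single 2 1 : Fin 3 → R) i := fun i => by
    rw [← h1 i, ← congrFun (congrFun hM 2) i, Matrix.transpose_apply]
  ext i j
  fin_cases i <;> fin_cases j <;> simp [blockDiag, topBlock, h1, h2]

/-- `blockDiag` as a ring homomorphism. -/
def blockDiagHom : Matrix (Fin 2) (Fin 2) ℂ × ℂ →+* Matrix (Fin 3) (Fin 3) ℂ where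
  toFun x := blockDiag x.1 x.2
  map_one' := by
    ext i j
    fin_cases i <;> fin_cases j <;> simp [blockDiag]
  map_zero' := by
    ext i j
    fin_cases i <;> fin_cases j <;> simp [blockDiag]
  map_add' x y := by
    ext i j
    fin_cases i <;> fin_cases j <;> simp [blockDiag]
  map_mul' x y := by
    ext i j
    fin_cases i <;> fin_cases j <;> simp [blockDiag, Matrix.mul_apply, Fin.sum_univ_succ]

lemma continuous_blockDiagHom : Continuous blockDiagHom := by
  refine continuous_pi fun i => continuous_pi fun j => ?_
  have h : ∀ k l : Fin 2, Continuous fun x : Matrix (Fin 2) (Fin 2) ℂ × ℂ => x.1 k l :=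
    fun k l => continuous_fst.matrix_elem k l
  fin_cases i <;> fin_cases j <;>
    simp [blockDiagHom, blockDiag, h, continuous_const, continuous_snd]

open scoped Matrix.Norms.Operator in
lemma exp_blockDiag (B : Matrix (Fin 2) (Fin 2) ℂ) (b : ℂ) :
    NormedSpace.exp (blockDiag B b) = blockDiag (NormedSpace.exp B) (Complex.exp b) := by
  have h := NormedSpace.map_exp blockDiagHom continuous_blockDiagHom (B, b)
  have h2 : NormedSpace.exp (B, b) = (NormedSpace.exp B, NormedSpace.exp b) :=
    Prod.ext (Prod.fst_exp _) (Prod.snd_exp _)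
  rw [Complex.exp_eq_exp_ℂ]
  exact h.symm.trans (congrArg blockDiagHom h2)

lemma smul_blockDiag (c : ℂ) (B : Matrix (Fin 2) (Fin 2) ℂ) (b : ℂ) :
    c • blockDiag B b = blockDiag (c • B) (c * b) := by
  ext i j
  fin_cases i <;> fin_cases j <;> simp [blockDiag]

lemma rePart_blockDiag (B : Matrix (Fin 2) (Fin 2) ℂ) (b : ℂ) :
    rePart (blockDiag B b) = blockDiag (rePart B) (b.re : ℂ) := by
  have h : (1 / 2 : ℂ) * (b + star b) = (b.re : ℂ) := by
    rw [Complex.star_def, Complex.add_conj]; push_cast; ring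
  rw [← h]
  ext i j
  fin_cases i <;> fin_cases j <;> simp [blockDiag, rePart]

end BlockDiagonal

/-! ### Transverse isotropy -/

section TransverseIsotropy

variable {n : Fin 3 → ℝ}

lemma e₃_dotProduct (n : Fin 3 → ℝ) : e₃ ⬝ᵥ n = n 2 := by
  simp [e₃, dotProduct, Fin.sum_univ_three]

lemma transversePol_eq (n : Fin 3 → ℝ) :
    transversePol n = (Real.sqrt (1 - n 2 ^ 2))⁻¹ • ![-n 1, n 0, 0] := by
  rw [transversePol, e₃_dotProduct]
  congr 1
  rw [cross_apply]
  simp [e₃]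

lemma one_sub_sq_pos (hn : n ⬝ᵥ n = 1) (h : (e₃ ⬝ᵥ n) ^ 2 ≠ 1) : 0 < 1 - n 2 ^ 2 := by
  rw [e₃_dotProduct] at h
  simp only [dotProduct, Fin.sum_univ_three] at hn
  have : n 2 ^ 2 ≤ 1 := by nlinarith [sq_nonneg (n 0), sq_nonneg (n 1)]
  exact sub_pos.2 (lt_of_le_of_ne this h)

lemma transversePol_dotProduct_self (hn : n ⬝ᵥ n = 1) (h : (e₃ ⬝ᵥ n) ^ 2 ≠ 1) :
    transversePol n ⬝ᵥ transversePol n = 1 := by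
  have h0 := one_sub_sq_pos hn h
  have h1 : (![-n 1, n 0, 0] : Fin 3 → ℝ) ⬝ᵥ ![-n 1, n 0, 0] = 1 - n 2 ^ 2 := by
    simp only [dotProduct, Fin.sum_univ_three] at hn
    simp [dotProduct, Fin.sum_univ_three]
    linarith
  rw [transversePol_eq, smul_dotProduct, dotProduct_smul, smul_smul, ← mul_inv,
    Real.mul_self_sqrt h0.le, h1, smul_eq_mul, inv_mul_cancel₀ h0.ne']

/-- In a transversely isotropic medium `e₃ × n` is an eigenvector of `Q_n(p)`. -/
lemma matrixQ_mulVec_transversePol {G : ℝ → Tensor4 3} {q11 q12 q13 q33 q44 q66 : ℝ → ℝ}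
    (hG : IsSolidModulus G) (hT : IsTransverselyIsotropic G q11 q12 q13 q33 q44 q66)
    (hn : n ⬝ᵥ n = 1) {p : ℝ} (hp : 0 < p) :
    matrixQ G n p *ᵥ transversePol n =
      (q66 p * (1 - (e₃ ⬝ᵥ n) ^ 2) + q44 p * (e₃ ⬝ᵥ n) ^ 2) • transversePol n := by
  obtain ⟨hV, h12⟩ := hT p hp
  have hs := hG.isSymmetric_modulusQ p
  rw [matrixQ]
  generalize modulusQ G p = H at hV hs
  have hV' : ∀ I J, H (voigtPair I).1 (voigtPair I).2 (voigtPair J).1 (voigtPair J).2 = _ :=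
    fun I J => congrFun (congrFun hV I) J
  have a1 : ∀ k l, H 1 0 k l = H 0 1 k l := fun k l => hs.1 _ _ _ _
  have a2 : ∀ k l, H 2 0 k l = H 0 2 k l := fun k l => hs.1 _ _ _ _
  have a3 : ∀ k l, H 2 1 k l = H 1 2 k l := fun k l => hs.1 _ _ _ _
  have b1 : ∀ i j, H i j 1 0 = H i j 0 1 := fun i j => hs.minor _ _ _ _
  have b2 : ∀ i j, H i j 2 0 = H i j 0 2 := fun i j => hs.minor _ _ _ _
  have b3 : ∀ i j, H i j 2 1 = H i j 1 2 := fun i j => hs.minor _ _ _ _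
  simp only [Fin.forall_fin_succ, voigtPair] at hV'
  simp at hV'
  have hn' : n 0 ^ 2 + n 1 ^ 2 = 1 - n 2 ^ 2 := by
    simp only [dotProduct, Fin.sum_univ_three] at hn
    linarith
  rw [transversePol_eq, Matrix.mulVec_smul, smul_comm, e₃_dotProduct]
  congr 1
  rw [← hn']
  funext i
  fin_cases i <;>
    simp [Matrix.mulVec, dotProduct, Tensor4.contract, Fin.sum_univ_three, a1, a2, a3, b1, b2, b3,
      hV', h12] <;> ring

/-- The rotation with rows `e₃`, `f × e₃`, `f` takes a horizontal unit vector `f` to `e₃`. -/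
lemma exists_rotation (hn : n ⬝ᵥ n = 1) (h : (e₃ ⬝ᵥ n) ^ 2 ≠ 1) :
    ∃ R ∈ Matrix.specialOrthogonalGroup (Fin 3) ℝ, R *ᵥ transversePol n = e₃ := by
  have hf := transversePol_dotProduct_self hn h
  have hf2 : transversePol n 2 = 0 := by rw [transversePol_eq]; simp
  generalize transversePol n = f at hf hf2
  have hf' : f 0 * f 0 + f 1 * f 1 = 1 := by
    simp only [dotProduct, Fin.sum_univ_three, hf2] at hf
    linarith
  refine ⟨!![0, 0, 1; f 1, -f 0, 0; f 0, f 1, 0], ?_, ?_⟩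
  · rw [Matrix.mem_specialOrthogonalGroup_iff, Matrix.mem_orthogonalGroup_iff]
    refine ⟨?_, ?_⟩
    · ext i j
      fin_cases i <;> fin_cases j <;>
        simp [Matrix.mul_apply, Fin.sum_univ_three] <;> linarith
    · rw [Matrix.det_fin_three]
      simp
      linarith
  · funext i
    fin_cases i <;>
      simp [Matrix.mulVec, dotProduct, Fin.sum_univ_three, e₃, hf2] <;> linarith

end TransverseIsotropy

lemma e₃_eq : e₃ = Pi.single 2 1 := by
  funext i
  fin_cases i <;> simp [e₃]

/-- In coordinates in which an eigenvector `f` is the third axis, a symmetric matrix is block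
diagonal. -/
lemma conj_eq_blockDiag {S : Type} [CommRing S] {R K : Matrix (Fin 3) (Fin 3) S} {f : Fin 3 → S}
    {k : S} (hR : Rᵀ * R = 1) (hRf : R *ᵥ f = Pi.single 2 1) (hK : Kᵀ = K) (hf : K *ᵥ f = k • f) :
    R * K * Rᵀ = blockDiag (topBlock (R * K * Rᵀ)) k := by
  refine eq_blockDiag_topBlock ?_ ?_
  · rw [Matrix.transpose_mul, Matrix.transpose_mul, Matrix.transpose_transpose, hK,
      Matrix.mul_assoc]
  · have h1 : Rᵀ *ᵥ Pi.single 2 1 = f := by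
      rw [← hRf, Matrix.mulVec_mulVec, hR, Matrix.one_mulVec]
    rw [← Matrix.mulVec_mulVec, h1, ← Matrix.mulVec_mulVec, hf, Matrix.mulVec_smul, hRf]

end Viscoelastic

end

theorem mainTheorem8 :
    -- a constant unit eigenvector of `K_n(p)` has a complete Bernstein eigenvalue
    (∀ (d : ℕ) (ρ : ℝ) (G : ℝ → Tensor4 d) (n f : Fin d → ℝ) (κ : ℝ → ℝ),
      0 < ρ → IsSolidModulus G → n ⬝ᵥ n = 1 → f ⬝ᵥ f = 1 →
      (∀ p : ℝ, 0 < p → matrixK ρ G n p *ᵥ f = κ p • f) →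
      (∀ p : ℝ, 0 < p → κ p = f ⬝ᵥ (matrixK ρ G n p *ᵥ f)) ∧ IsCBF κ) ∧
    -- the transverse mode of a transversely isotropic medium
    (∀ (ρ : ℝ) (G : ℝ → Tensor4 3) (q11 q12 q13 q33 q44 q66 : ℝ → ℝ) (n : Fin 3 → ℝ),
      0 < ρ → IsSolidModulus G → IsTransverselyIsotropic G q11 q12 q13 q33 q44 q66 →
      n ⬝ᵥ n = 1 → (e₃ ⬝ᵥ n) ^ 2 ≠ 1 →
      ∃ (f : Fin 3 → ℝ) (qT κT cT : ℝ → ℝ) (κc : ℂ → ℂ) (Kc : ℂ → Matrix (Fin 3) (Fin 3) ℂ),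
        f = transversePol n ∧ f ⬝ᵥ f = 1 ∧
        (∀ p : ℝ, qT p = q66 p * (1 - (e₃ ⬝ᵥ n) ^ 2) + q44 p * (e₃ ⬝ᵥ n) ^ 2) ∧
        (∀ p : ℝ, 0 < p →
          0 < qT p ∧ κT p = Real.sqrt ρ * p / Real.sqrt (qT p) ∧
          matrixQ G n p *ᵥ f = qT p • f ∧ matrixK ρ G n p *ᵥ f = κT p • f) ∧
        IsCBF κT ∧ IsContinuation κT κc ∧ IsMatrixContinuation (matrixK ρ G n) Kc ∧
        -- the scalar phase speed and attenuation of the transverse mode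
        (∀ w : ℝ, w ≠ 0 →
          0 ≤ (κc (-Complex.I * w)).re ∧ 0 < cT w ∧
          κc (-Complex.I * w) = -Complex.I * w / cT w + (κc (-Complex.I * w)).re) ∧
        -- the decoupling, in the rotated coordinates in which `f` becomes the third axis
        (∃ R ∈ Matrix.specialOrthogonalGroup (Fin 3) ℝ, R *ᵥ f = e₃) ∧
        (∀ R ∈ Matrix.specialOrthogonalGroup (Fin 3) ℝ, R *ᵥ f = e₃ →
          ∃ (Kp : ℝ → Matrix (Fin 2) (Fin 2) ℝ) (Kpc : ℂ → Matrix (Fin 2) (Fin 2) ℂ),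
            IsMatrixCBF Kp ∧ IsMatrixContinuation Kp Kpc ∧
            (∀ p : ℝ, 0 < p → R * matrixK ρ G n p * Rᵀ = blockDiag (Kp p) (κT p)) ∧
            (∀ z ∈ Complex.slitPlane,
              toC R * Kc z * toC Rᵀ = blockDiag (Kpc z) (κc z) ∧
              ∀ y : ℝ, toC R * NormedSpace.exp (-(y : ℂ) • Kc z) * toC Rᵀ =
                blockDiag (NormedSpace.exp (-(y : ℂ) • Kpc z)) (Complex.exp (-(y : ℂ) * κc z))) ∧
            (∀ w : ℝ, w ≠ 0 →
              toC R * rePart (Kc (-Complex.I * w)) * toC Rᵀ =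
                blockDiag (rePart (Kpc (-Complex.I * w))) ((κc (-Complex.I * w)).re : ℂ) ∧
              (rePart (Kpc (-Complex.I * w))).PosSemidef))) := by
  refine ⟨fun d ρ G n f κ hρ hG hn hf hκ => ⟨fun p hp => eigenvalue_eq hf (hκ p hp),
    hG.isCBF_eigenvalue hn hρ hf hκ⟩, ?_⟩
  intro ρ G q11 q12 q13 q33 q44 q66 n hρ hG hT hn hen
  set qT : ℝ → ℝ := fun p => q66 p * (1 - (e₃ ⬝ᵥ n) ^ 2) + q44 p * (e₃ ⬝ᵥ n) ^ 2
  set κT : ℝ → ℝ := fun p => Real.sqrt ρ * p / Real.sqrt (qT p) with hκT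
  set f := transversePol n
  obtain ⟨Kc, hKc, him, hre⟩ := hG.exists_continuation_matrixK hn hρ
  have hff : f ⬝ᵥ f = 1 := transversePol_dotProduct_self hn hen
  have hQf : ∀ p, 0 < p → matrixQ G n p *ᵥ f = qT p • f := fun p hp =>
    matrixQ_mulVec_transversePol hG hT hn hp
  have hf0 : f ≠ 0 := by
    intro h
    simp [h] at hff
  have hf0' : vecC f ≠ 0 := fun h =>
    hf0 (funext fun i => Complex.ofReal_eq_zero.1 (congrFun h i))
  have hqpos : ∀ p, 0 < p → 0 < qT p := by
    intro p hp
    have := (hG.posDef_matrixQ hn hp).dotProduct_mulVec_pos hf0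
    rwa [star_trivial, ← eigenvalue_eq hff (hQf p hp)] at this
  have hKf : ∀ p, 0 < p → matrixK ρ G n p *ᵥ f = κT p • f := by
    intro p hp
    rw [matrixK, Matrix.smul_mulVec, inv_cfc_sqrt_mulVec_of_eigen (hG.posDef_matrixQ hn hp)
      (hqpos p hp) (hQf p hp), smul_smul]
    simp only [hκT, div_eq_mul_inv]
  set κc : ℂ → ℂ := fun z => vecC f ⬝ᵥ (Kc z *ᵥ vecC f)
  have hκcont : IsContinuation κT κc :=
    (hKc.quad f).congr fun p hp => (eigenvalue_eq hff (hKf p hp)).symm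
  -- both the eigenvector equation and the symmetry of `Kc` continue from `]0, ∞[`
  have hKcf : ∀ z ∈ Complex.slitPlane, Kc z *ᵥ vecC f = κc z • vecC f := by
    intro z hz
    funext i
    refine eqOn_slitPlane_of_eq_ofReal (H := fun z => (κc z • vecC f) i)
      (hKc.differentiableOn_mulVec (vecC f) i) (hκcont.1.mul_const _) (fun p hp => ?_) hz
    rw [hKc.apply_ofReal hp, toC_mulVec, hKf p hp, vecC_smul, hκcont.2 p hp]
  have hKsymm : ∀ z ∈ Complex.slitPlane, (Kc z)ᵀ = Kc z := fun z hz =>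
    hKc.transpose (fun p _ => transpose_matrixK ρ G n p) hz
  have hIw : ∀ w : ℝ, (-Complex.I * w).im = -w ∧ (-Complex.I * w).re = 0 := fun w => by simp
  have hIw' : ∀ w : ℝ, w ≠ 0 → -Complex.I * w ∈ Complex.slitPlane := fun w hw =>
    Or.inr (by rw [(hIw w).1]; exact neg_ne_zero.2 hw)
  have hκre : ∀ w : ℝ, w ≠ 0 → 0 ≤ (κc (-Complex.I * w)).re := fun w hw => by
    have := hre _ (hIw' w hw) (hIw w).2.ge (vecC f)
    rwa [star_vecC] at this
  have hκim : ∀ w : ℝ, w ≠ 0 → 0 < -w * (κc (-Complex.I * w)).im := fun w hw => by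
    have := him (-Complex.I * w) (by rw [(hIw w).1]; exact neg_ne_zero.2 hw) (vecC f) hf0'
    rwa [star_vecC, (hIw w).1] at this
  -- the phase speed is read off from the imaginary part of `κc (-i w)`, which is `-w / c`
  refine ⟨f, qT, κT, fun w => -w / (κc (-Complex.I * w)).im, κc, Kc, rfl, hff, fun p => rfl,
    fun p hp => ⟨hqpos p hp, rfl, hQf p hp, hKf p hp⟩, hG.isCBF_eigenvalue hn hρ hff hKf, hκcont,
    hKc, fun w hw => ⟨hκre w hw, ?_, ?_⟩, exists_rotation hn hen, fun R hR hRf => ?_⟩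
  · exact div_pos_iff.2 (mul_pos_iff.1 (hκim w hw))
  · have h1 := hκim w hw
    have h2 : (κc (-Complex.I * w)).im ≠ 0 := right_ne_zero_of_mul h1.ne'
    have h3 : (w : ℂ) ≠ 0 := Complex.ofReal_ne_zero.2 hw
    have h4 : ((κc (-Complex.I * w)).im : ℂ) ≠ 0 := Complex.ofReal_ne_zero.2 h2
    conv_lhs => rw [← Complex.re_add_im (κc (-Complex.I * w))]
    push_cast
    field_simp
    ring
  · have hRR : Rᵀ * R = 1 := by
      have := (Matrix.mem_orthogonalGroup_iff' (Fin 3) ℝ).1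
        (Matrix.mem_specialOrthogonalGroup_iff.1 hR).1
      simpa [Matrix.star_eq_conjTranspose] using this
    rw [e₃_eq] at hRf
    have hRRc : (toC R)ᵀ * toC R = 1 := by rw [← toC_transpose, ← toC_mul, hRR, toC_one]
    have hRRc' : toC R * toC Rᵀ = 1 := by
      rw [← toC_mul, mul_eq_one_comm.1 hRR, toC_one]
    have hRfc : toC R *ᵥ vecC f = Pi.single 2 1 := by rw [toC_mulVec, hRf, vecC_single]
    set Kp : ℝ → Matrix (Fin 2) (Fin 2) ℝ := fun p => topBlock (R * matrixK ρ G n p * Rᵀ)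
    set Kpc : ℂ → Matrix (Fin 2) (Fin 2) ℂ := fun z => topBlock (toC R * Kc z * toC Rᵀ)
    have hcont : IsMatrixContinuation Kp Kpc := fun i j => hKc.conj R _ _
    have hblock : ∀ z ∈ Complex.slitPlane,
        toC R * Kc z * toC Rᵀ = blockDiag (Kpc z) (κc z) := fun z hz =>
      conj_eq_blockDiag hRRc hRfc (hKsymm z hz) (hKcf z hz)
    have hrePart : ∀ w : ℝ, w ≠ 0 → toC R * rePart (Kc (-Complex.I * w)) * toC Rᵀ =
        blockDiag (rePart (Kpc (-Complex.I * w))) ((κc (-Complex.I * w)).re : ℂ) := by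
      intro w hw
      rw [← rePart_blockDiag, ← hblock _ (hIw' w hw), rePart_conj, toC_transpose_eq_conjTranspose]
    refine ⟨Kp, Kpc, ⟨⟨Kpc, hcont, fun z hz => ?_⟩, 0, Matrix.PosSemidef.zero, ?_⟩, hcont,
      fun p hp => conj_eq_blockDiag hRR hRf (transpose_matrixK ρ G n p) (hKf p hp),
      fun z hz => ⟨hblock z hz, fun y => ?_⟩, fun w hw => ⟨hrePart w hw, ?_⟩⟩
    · have h1 : ((z.im : ℂ) • imPart (Kc z)).PosSemidef := by
        refine posSemidef_smul_imPart fun v => ?_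
        rcases eq_or_ne v 0 with rfl | hv
        · simp
        by_cases h0 : z.im = 0
        · simp [h0]
        · exact (him z h0 v hv).le
      have h2 := (h1.mul_mul_conjTranspose_same (toC R)).submatrix ![0, 1]
      rw [Matrix.mul_smul, Matrix.smul_mul, ← imPart_conj] at h2
      exact h2
    · have hc : Continuous fun A : Matrix (Fin 3) (Fin 3) ℝ => topBlock (R * A * Rᵀ) := by
        unfold topBlock
        fun_prop
      have h0 : topBlock (R * 0 * Rᵀ) = 0 := by
        ext i j
        simp [topBlock]
      have hlim := (hc.tendsto 0).comp (hG.tendsto_matrixK hn ρ)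
      rw [h0] at hlim
      exact hlim
    · have hinv : (toC R)⁻¹ = toC Rᵀ := Matrix.inv_eq_right_inv hRRc'
      have hunit : IsUnit (toC R) := ⟨⟨toC R, toC Rᵀ, hRRc', mul_eq_one_comm.1 hRRc'⟩, rfl⟩
      rw [← hinv, ← Matrix.exp_conj _ _ hunit, hinv, Matrix.mul_smul, Matrix.smul_mul, hblock z hz,
        smul_blockDiag, exp_blockDiag]
    · have h1 : (rePart (Kc (-Complex.I * w))).PosSemidef :=
        posSemidef_rePart (hre _ (hIw' w hw) (hIw w).2.ge)
      have h2 := (h1.mul_mul_conjTranspose_same (toC R)).submatrix ![0, 1]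
      rw [← rePart_conj] at h2
      exact h2
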